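/- Let $\mathbb{C}_q=\mathbb{C}[q,q^{-1}]$. For $1\le i\le 5$ put $p(i)=0$ if $i\le 4$ and $p(5)=1$, and $\pi(a_{ij})=p(i)+p(j)$ (mod 2). Let $M_q(4|1)$ be Manin's quantum matrix superalgebra: the $\mathbb{C}_q$-algebra generated by $a_{ij}$, $1\le i,j\le 5$, subject to $$\begin{aligned} a_{ij}a_{il}&=(-1)^{\pi(a_{ij})\pi(a_{il})}q^{(-1)^{p(i)+1}}a_{il}a_{ij}, && j<l,\\ a_{ij}a_{kj}&=(-1)^{\pi(a_{ij})\pi(a_{kj})}q^{(-1)^{p(j)+1}}a_{kj}a_{ij}, && i<k,\\ a_{ij}a_{kl}&=(-1)^{\pi(a_{ij})\pi(a_{kl})}a_{kl}a_{ij}, && i<k,\ j>l\ \text{ or }\ i>k,\ j<l,\\ a_{ij}a_{kl}-(-1)^{\pi(a_{ij})\pi(a_{kl})}a_{kl}a_{ij}&=(-1)^{\pi(a_{ij})\pi(a_{kj})}(q^{-1}-q)\,a_{kj}a_{il}, && i<k,\ j<l,\\ a_{ij}^2&=0, && \pi(a_{ij})=1. \end{aligned}$$ Let $\mathrm{GL}_q(4|1)$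 be obtained from $M_q(4|1)$ by adjoining two-sided inverses of $D_1=\sum_{\sigma\in S_4}(-q)^{-l(\sigma)}a_{1\sigma(1)}\cdots a_{4\sigma(4)}$ and $D_2=a_{55}$. Let $Gr_q\subset \mathrm{GL}_q(4|1)$ be the $\mathbb{C}_q$-subalgebra generated by the eleven quantum super minors $$D_{ij}=a_{i1}a_{j2}-q^{-1}a_{i2}a_{j1}\quad(1\le i<j\le 5),\qquad D_{55}=a_{51}a_{52}.$$ (1) Let $I_{Gr}$ be the two-sided ideal of the free algebra $\mathbb{C}_q\langle X_{ij}\ (1\le i<j\le5),\ X_{55}\rangle$ generated by the following commutation and quantum super Plücker relations: * $X_{ij}X_{kl}=q^{-1}X_{kl}X_{ij}$ for $i<j$, $k<l$, $(i,j)<(k,l)$ lexicographically, $\{i,j\}\cap\{k,l\}\neq\emptyset$ and not $j=l=5$; * $X_{ij}X_{kl}=q^{-2}X_{kl}X_{ij}$ for $1\le i<j<k<l\le 5$; * $X_{ij}X_{kl}=q^{-2}X_{kl}X_{ij}-(q^{-1}-q)X_{ik}X_{jl}$ for $1\le i<k<j<l\le5$; * $X_{ij}X_{kl}=X_{kl}X_{ij}$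 for $1\le i<k<l<j\le5$; * $X_{ij}X_{55}=q^{-2}X_{55}X_{ij}$ and $X_{i5}X_{j5}=-q^{-1}X_{j5}X_{i5}-(q^{-1}-q)X_{ij}X_{55}$ for $1\le i<j\le4$; * $X_{i5}X_{55}=X_{55}X_{i5}=0$ and $X_{i5}^2=0$ for $1\le i\le 4$, and $X_{55}^2=0$; * $X_{12}X_{34}-q^{-1}X_{13}X_{24}+q^{-2}X_{14}X_{23}=0$; * $X_{ij}X_{k5}-q^{-1}X_{ik}X_{j5}+q^{-2}X_{i5}X_{jk}=0$ for $1\le i<j<k\le4$; * $X_{i5}X_{j5}=q\,X_{ij}X_{55}$ for $1\le i<j\le4$. Then $X_{ij}\mapsto D_{ij}$, $X_{55}\mapsto D_{55}$ induces an isomorphism of $\mathbb{C}_q$-algebras $\mathbb{C}_q\langle X_{ij}\rangle/I_{Gr}\cong Gr_q$. (2) Let $\mathcal{O}(\mathrm{Gr})$ be the quotient of the polynomial superalgebra $\mathbb{C}[q_{ij},a_{55},\lambda_k]$ (supercommuting variables: $q_{ij}$, $1\le i<j\le4$, and $a_{55}$ even; $\lambda_k$, $1\le k\le4$, odd) by the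 super Plücker relations $$q_{12}q_{34}-q_{13}q_{24}+q_{14}q_{23}=0,\qquad q_{ij}\lambda_k-q_{ik}\lambda_j+q_{jk}\lambda_i=0\ (i<j<k\le4),$$ $$\lambda_i\lambda_j=a_{55}q_{ij}\ (i<j\le4),\qquad \lambda_ia_{55}=0\ (i\le 4),\qquad a_{55}^2=0.$$ Then $D_{ij}\mapsto q_{ij}$ ($i<j\le4$), $D_{i5}\mapsto\lambda_i$ ($i\le4$), $D_{55}\mapsto a_{55}$ induces an isomorphism of $\mathbb{C}$-algebras $Gr_q/(q-1)\cong\mathcal{O}(\mathrm{Gr})$. (3) $Gr_q$ is a free $\mathbb{C}_q$-module, with basis the monomials $D_{i_1j_1}\cdots D_{i_rj_r}$, $r\ge0$, indexed by the semistandard tableaux with rows $(i_1,j_1),\dots,(i_r,j_r)$ from top to bottom: every row has $1\le i_s<j_s\le5$ or $(i_s,j_s)=(5,5)$, both columns are weakly increasing, and the entry $5$ occurs at most once in each column. -/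

import Mathlib

open scoped LaurentPolynomial

namespace QuantumGr

/-- The ground ring `ℂ_q = ℂ[q, q⁻¹]`. -/
abbrev Cq : Type := LaurentPolynomial ℂ

/-- The power `q ^ k` of the indeterminate, for an integer `k`. -/
noncomputable abbrev qpow (k : ℤ) : Cq := LaurentPolynomial.T k

/-! ### The quantum matrix superalgebra and the quantum general linear supergroup -/

section QuantumMatrices

variable (m n : ℕ)

/-- The parity `p(i)` of a row or column index: the first `m` indices are even, the last `n` are
odd. Indices are counted from `0`. -/
def idxParity (i : Fin (m + n)) : ℕ := if (i : ℕ) < m then 0 else 1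

/-- The parity `π(a_ij) = p(i) + p(j)` of a matrix entry; only its class modulo `2` matters. -/
def entryParity (i j : Fin (m + n)) : ℕ := idxParity m n i + idxParity m n j

/-- The sign `(-1) ^ (π(a_ij) π(a_kl))`. -/
noncomputable def entrySign (i j k l : Fin (m + n)) : Cq :=
  (-1) ^ (entryParity m n i j * entryParity m n k l)

/-- The scalar `q ^ ((-1) ^ (p(i) + 1))`. -/
noncomputable def qIdx (i : Fin (m + n)) : Cq := qpow ((-1) ^ (idxParity m n i + 1))

/-- The free generator `a_ij`. -/
noncomputable def fa (i j : Fin (m + n)) : FreeAlgebra Cq (Fin (m + n) × Fin (m + n)) :=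
  FreeAlgebra.ι Cq (i, j)

/-- Manin's relations for the quantum matrix superalgebra `M_q(m|n)`. The last constructor says
that the odd generators square to zero. -/
inductive MqRel : FreeAlgebra Cq (Fin (m + n) × Fin (m + n)) →
    FreeAlgebra Cq (Fin (m + n) × Fin (m + n)) → Prop
  | row (i j l : Fin (m + n)) (h : j < l) :
      MqRel (fa m n i j * fa m n i l)
        ((entrySign m n i j i l * qIdx m n i) • (fa m n i l * fa m n i j))
  | col (i k j : Fin (m + n)) (h : i < k) :
      MqRel (fa m n i j * fa m n k j)
        ((entrySign m n i j k j * qIdx m n j) • (fa m n k j * fa m n i j))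
  | anti (i j k l : Fin (m + n)) (h : (i < k ∧ l < j) ∨ (k < i ∧ j < l)) :
      MqRel (fa m n i j * fa m n k l) (entrySign m n i j k l • (fa m n k l * fa m n i j))
  | diag (i j k l : Fin (m + n)) (hik : i < k) (hjl : j < l) :
      MqRel (fa m n i j * fa m n k l - entrySign m n i j k l • (fa m n k l * fa m n i j))
        ((entrySign m n i j k j * (qpow (-1) - qpow 1)) • (fa m n k j * fa m n i l))
  | oddSq (i j : Fin (m + n)) (h : entryParity m n i j = 1) :
      MqRel (fa m n i j * fa m n i j) 0

/-- The generators of `GL_q(m|n)`: the matrix entries and the two formal inverses. -/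
inductive GLGen : Type
  | entry (i j : Fin (m + n)) : GLGen
  | invD1 : GLGen
  | invD2 : GLGen

/-- The inclusion of the free algebra on the entries into the free algebra on all generators. -/
noncomputable def entryHom :
    FreeAlgebra Cq (Fin (m + n) × Fin (m + n)) →ₐ[Cq] FreeAlgebra Cq (GLGen m n) :=
  FreeAlgebra.lift Cq fun x => FreeAlgebra.ι Cq (GLGen.entry x.1 x.2)

end QuantumMatrices

/-- The length `l(σ)` of a permutation, i.e. its number of inversions. -/
def permLength {r : ℕ} (σ : Equiv.Perm (Fin r)) : ℕ :=
  (Finset.univ.filter fun x : Fin r × Fin r => x.1 < x.2 ∧ σ x.2 < σ x.1).card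

/-- `∑_σ (-q) ^ (e l(σ)) x_{1 σ(1)} ⋯ x_{r σ(r)}` with ordered products; the quantum determinants
of the diagonal blocks use `e = -1` and `e = 1`. -/
noncomputable def qDet {A : Type*} [Ring A] [Algebra Cq A] {r : ℕ} (e : ℤ)
    (x : Fin r → Fin r → A) : A :=
  ∑ σ : Equiv.Perm (Fin r),
    ((-1 : Cq) ^ permLength σ * qpow (e * (permLength σ : ℤ))) •
      (List.ofFn fun i => x i (σ i)).prod

section QuantumGL

variable (m n : ℕ)

/-- The quantum determinant `D_1` of the upper left `m × m` block. -/
noncomputable def detOne : FreeAlgebra Cq (GLGen m n) :=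
  qDet (-1) fun i j : Fin m =>
    FreeAlgebra.ι Cq (GLGen.entry (Fin.castAdd n i) (Fin.castAdd n j))

/-- The quantum determinant `D_2` of the lower right `n × n` block. -/
noncomputable def detTwo : FreeAlgebra Cq (GLGen m n) :=
  qDet 1 fun i j : Fin n =>
    FreeAlgebra.ι Cq (GLGen.entry (Fin.natAdd m i) (Fin.natAdd m j))

/-- The relations of `GL_q(m|n) = M_q(m|n)⟨D_1⁻¹, D_2⁻¹⟩`. -/
inductive GLqRel : FreeAlgebra Cq (GLGen m n) → FreeAlgebra Cq (GLGen m n) → Prop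
  | mat {x y : FreeAlgebra Cq (Fin (m + n) × Fin (m + n))} (h : MqRel m n x y) :
      GLqRel (entryHom m n x) (entryHom m n y)
  | d1_right : GLqRel (detOne m n * FreeAlgebra.ι Cq GLGen.invD1) 1
  | d1_left : GLqRel (FreeAlgebra.ι Cq GLGen.invD1 * detOne m n) 1
  | d2_right : GLqRel (detTwo m n * FreeAlgebra.ι Cq GLGen.invD2) 1
  | d2_left : GLqRel (FreeAlgebra.ι Cq GLGen.invD2 * detTwo m n) 1

/-- The quantum general linear supergroup `GL_q(m|n)`, as a `ℂ_q`-algebra. -/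
abbrev GLq : Type := RingQuot (GLqRel m n)

/-- The matrix entry `a_ij` of `GL_q(m|n)`. -/
noncomputable def entry (i j : Fin (m + n)) : GLq m n :=
  RingQuot.mkAlgHom Cq (GLqRel m n) (FreeAlgebra.ι Cq (GLGen.entry i j))

end QuantumGL

/-! ### The quantum super Grassmannian

Indices `1, …, 5` are represented by `0, …, 4 : Fin 5`; the odd index `5` is `4 : Fin 5`. -/

/-- The eleven labels `(i, j)` with `i < j`, and `(5, 5)`. -/
inductive PIdx : Type
  | pair (i j : Fin 5) (h : i < j) : PIdx
  | d55 : PIdx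

namespace PIdx

/-- The first index of a label. -/
def fst : PIdx → Fin 5
  | pair i _ _ => i
  | d55 => 4

/-- The second index of a label. -/
def snd : PIdx → Fin 5
  | pair _ j _ => j
  | d55 => 4

/-- The parity of a label: `(i, 5)` with `i ≤ 4` is odd, all others are even. -/
def parity : PIdx → ℕ
  | pair _ j _ => if j = 4 then 1 else 0
  | d55 => 0

end PIdx

/-- The quantum super minors `D_ij`, `D_i5`, `D_55` in `GL_q(4|1)`, on the first two columns. -/
noncomputable def qMinor : PIdx → GLq 4 1
  | PIdx.pair i j _ =>
      entry 4 1 i 0 * entry 4 1 j 1 - qpow (-1) • (entry 4 1 i 1 * entry 4 1 j 0)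
  | PIdx.d55 => entry 4 1 4 0 * entry 4 1 4 1

/-- The quantum super Grassmannian `Gr_q`: the subalgebra of `GL_q(4|1)` generated by the quantum
super minors. -/
noncomputable def Grq : Subalgebra Cq (GLq 4 1) := Algebra.adjoin Cq (Set.range qMinor)

/-- The quantum super minors as elements of `Gr_q`. -/
noncomputable def grGen (p : PIdx) : Grq :=
  ⟨qMinor p, Algebra.subset_adjoin (Set.mem_range_self p)⟩

/-- The free variable `X_ij`, `i < j`. -/
noncomputable def X (i j : Fin 5) (h : i < j) : FreeAlgebra Cq PIdx :=
  FreeAlgebra.ι Cq (PIdx.pair i j h)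

/-- The free variable `X_55`. -/
noncomputable def X55 : FreeAlgebra Cq PIdx := FreeAlgebra.ι Cq PIdx.d55

/-- The commutation relations and the quantum super Plücker relations; they generate `I_Gr`. -/
inductive GrRel : FreeAlgebra Cq PIdx → FreeAlgebra Cq PIdx → Prop
  /-- Commutation relations for two pairs with a common index, except two pairs `(i, 5)`,
  `(k, 5)`; here `(i, j) < (k, l)` lexicographically. -/
  | comm_overlap (i j k l : Fin 5) (hij : i < j) (hkl : k < l)
      (hlex : i < k ∨ (i = k ∧ j < l)) (hcommon : i = k ∨ i = l ∨ j = k ∨ j = l)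
      (hodd : ¬ (j = 4 ∧ l = 4)) :
      GrRel (X i j hij * X k l hkl) (qpow (-1) • (X k l hkl * X i j hij))
  | comm_disjoint (i j k l : Fin 5) (hij : i < j) (hjk : j < k) (hkl : k < l) :
      GrRel (X i j hij * X k l hkl) (qpow (-2) • (X k l hkl * X i j hij))
  | comm_crossing (i k j l : Fin 5) (hik : i < k) (hkj : k < j) (hjl : j < l) :
      GrRel (X i j (hik.trans hkj) * X k l (hkj.trans hjl))
        (qpow (-2) • (X k l (hkj.trans hjl) * X i j (hik.trans hkj)) -
          (qpow (-1) - qpow 1) • (X i k hik * X j l hjl))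
  | comm_nested (i k l j : Fin 5) (hik : i < k) (hkl : k < l) (hlj : l < j) :
      GrRel (X i j (hik.trans (hkl.trans hlj)) * X k l hkl)
        (X k l hkl * X i j (hik.trans (hkl.trans hlj)))
  | comm_even_55 (i j : Fin 5) (hij : i < j) (hj : j < 4) :
      GrRel (X i j hij * X55) (qpow (-2) • (X55 * X i j hij))
  | comm_odd_odd (i j : Fin 5) (hij : i < j) (hj : j < 4) :
      GrRel (X i 4 (hij.trans hj) * X j 4 hj)
        (-(qpow (-1) • (X j 4 hj * X i 4 (hij.trans hj))) -
          (qpow (-1) - qpow 1) • (X i j hij * X55))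
  | odd_mul_55 (i : Fin 5) (hi : i < 4) : GrRel (X i 4 hi * X55) 0
  | mul_55_odd (i : Fin 5) (hi : i < 4) : GrRel (X55 * X i 4 hi) 0
  | odd_sq (i : Fin 5) (hi : i < 4) : GrRel (X i 4 hi * X i 4 hi) 0
  | sq_55 : GrRel (X55 * X55) 0
  | plucker_even :
      GrRel (X 0 1 (by decide) * X 2 3 (by decide)
        - qpow (-1) • (X 0 2 (by decide) * X 1 3 (by decide))
        + qpow (-2) • (X 0 3 (by decide) * X 1 2 (by decide))) 0
  | plucker_odd (i j k : Fin 5) (hij : i < j) (hjk : j < k) (hk : k < 4) :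
      GrRel (X i j hij * X k 4 hk
        - qpow (-1) • (X i k (hij.trans hjk) * X j 4 (hjk.trans hk))
        + qpow (-2) • (X i 4 (hij.trans (hjk.trans hk)) * X j k hjk)) 0
  | plucker_55 (i j : Fin 5) (hij : i < j) (hj : j < 4) :
      GrRel (X i 4 (hij.trans hj) * X j 4 hj) (qpow 1 • (X i j hij * X55))

/-- The algebra `ℂ_q⟨X_ij⟩ / I_Gr`. -/
abbrev GrPresented : Type := RingQuot (GrRel)

/-- The class of `X_p` in `ℂ_q⟨X_ij⟩ / I_Gr`. -/
noncomputable def presGen (p : PIdx) : GrPresented :=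
  RingQuot.mkAlgHom Cq GrRel (FreeAlgebra.ι Cq p)

/-! ### The classical super Grassmannian and the specialization at `q = 1` -/

/-- The free variable `q_ij` (for `j ≤ 4`) respectively `λ_i` (for `j = 5`). -/
noncomputable def x (i j : Fin 5) (h : i < j) : FreeAlgebra ℂ PIdx :=
  FreeAlgebra.ι ℂ (PIdx.pair i j h)

/-- The free variable `a_55`. -/
noncomputable def x55 : FreeAlgebra ℂ PIdx := FreeAlgebra.ι ℂ PIdx.d55

/-- Supercommutativity of the variables `q_ij` (even), `λ_i` (odd), `a_55` (even), and the super
Plücker relations. -/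
inductive OGrRel : FreeAlgebra ℂ PIdx → FreeAlgebra ℂ PIdx → Prop
  | supercomm (p r : PIdx) :
      OGrRel (FreeAlgebra.ι ℂ p * FreeAlgebra.ι ℂ r)
        ((-1 : ℂ) ^ (p.parity * r.parity) • (FreeAlgebra.ι ℂ r * FreeAlgebra.ι ℂ p))
  | plucker_even :
      OGrRel (x 0 1 (by decide) * x 2 3 (by decide) - x 0 2 (by decide) * x 1 3 (by decide)
        + x 0 3 (by decide) * x 1 2 (by decide)) 0
  | plucker_odd (i j k : Fin 5) (hij : i < j) (hjk : j < k) (hk : k < 4) :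
      OGrRel (x i j hij * x k 4 hk - x i k (hij.trans hjk) * x j 4 (hjk.trans hk)
        + x j k hjk * x i 4 (hij.trans (hjk.trans hk))) 0
  | plucker_55 (i j : Fin 5) (hij : i < j) (hj : j < 4) :
      OGrRel (x i 4 (hij.trans hj) * x j 4 hj) (x55 * x i j hij)
  | odd_mul_55 (i : Fin 5) (hi : i < 4) : OGrRel (x i 4 hi * x55) 0
  | sq_55 : OGrRel (x55 * x55) 0

/-- The coordinate superalgebra `O(Gr) = ℂ[q_ij, λ_k, a_55] / I_P`. -/
abbrev OGr : Type := RingQuot OGrRel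

/-- The Plücker coordinates in `O(Gr)`. -/
noncomputable def oGen (p : PIdx) : OGr := RingQuot.mkAlgHom ℂ OGrRel (FreeAlgebra.ι ℂ p)

/-- The relation `q = 1` in `Gr_q`. -/
inductive SpecRel : Grq → Grq → Prop
  | q_eq_one : SpecRel (algebraMap Cq Grq (qpow 1)) 1

/-- The specialization `Gr_q / (q - 1)`. -/
abbrev GrqAtOne : Type := RingQuot SpecRel

/-- The class of `D_p` in `Gr_q / (q - 1)`. -/
noncomputable def specGen (p : PIdx) : GrqAtOne := RingQuot.mkRingHom SpecRel (grGen p)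

/-! ### Semistandard tableaux -/

/-- Row `p` may stand directly above row `r`: the columns increase weakly, and the odd index `5`
is not repeated in a column. -/
def RowAbove (p r : PIdx) : Prop :=
  p.fst ≤ r.fst ∧ p.snd ≤ r.snd ∧ ¬ (p.fst = 4 ∧ r.fst = 4) ∧ ¬ (p.snd = 4 ∧ r.snd = 4)

/-- Semistandard tableaux with two columns and entries in `{1, …, 5}`, given as the list of their
rows from top to bottom. Each row increases strictly, except that it may be `(5, 5)`. -/
def Tableau : Type := {t : List PIdx // t.IsChain RowAbove}

/-- The monomial `D_{i_1 j_1} ⋯ D_{i_r j_r}` in `Gr_q` of a tableau with rows `(i_s, j_s)`. -/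
noncomputable def tableauMonomial (t : Tableau) : Grq := (t.1.map grGen).prod

end QuantumGr

/-! The presented algebra is bounded from above by straightening and from below by a representation
in which the semistandard monomials are visibly independent.

Upper bound. Any two generators which cannot stand as consecutive rows of a semistandard tableau
have a product that the relations rewrite through products with a lexicographically smaller first
factor (`presGen_mul_mem_smallerProducts`). The length of a word is kept, so the process ends, and
the semistandard monomials span (`standardSpan_eq_top`). The relations themselves hold for the
minors by normal ordering in two columns (`evalMinors_rel`).

Lower bound. It must be shown that inverting `D_1` and `D_2` does not collapse the minors, so a
representation of `GL_q(4|1)` is built. Manin's relations amount to an R-matrix identity together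
with the vanishing of odd squares; the identity is inherited by a product of two matrices whose
entries supercommute (`IsRTT.matMul`). Take a product L R of two lower triangular matrices of
weighted shifts on a free `Cq`-module with basis the integral exponent vectors. It is lower
triangular with invertible diagonal, so both quantum determinants act invertibly. Odd entries are
truncated shifts, which makes them square to zero.

Filter the module by the total exponent belonging to R. With indices counted from 0, the minor
labelled (i, j) has leading part L_{i0} R_{00} L_{jj} R_{j1}, a single weighted shift. A
semistandard monomial applied to the basis vector at 0 thus has one leading basis vector, with unit
coefficient (`rep_word_apply`). The exponent of that vector counts the entries of each column that
are at least m, and the rows, so it determines the tableau (`wordVec_injective`). Independence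
follows over `Cq` itself, since the coefficients are units and not merely nonzero.

Together the two bounds give the basis and the injectivity of the presentation map. At q = 1 the
defining relations become those of `O(Gr)` and conversely, which yields mutually inverse
homomorphisms between `Gr_q / (q - 1)` and `O(Gr)`. -/

namespace QuantumGr

set_option linter.unusedSimpArgs false

/-! ### Minors of a two-column quantum matrix -/

section Minors

variable {K A : Type*} [CommRing K] [Ring A] [Algebra K A]

/-- The relations between the rows `(x, y)` and `(x', y')` of a quantum matrix with two columns,
the first row being above the second one. Here `p` plays the role of `q⁻¹`. -/
structure RowRel (q p : K) (x y x' y' : A) : Prop where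
  xx : x * x' = p • (x' * x)
  yy : y * y' = p • (y' * y)
  xy' : x * y' = y' * x + (p - q) • (y * x')
  x'y : x' * y = y * x'

namespace RowRel

variable {q p : K} {x y x' y' : A}

theorem yy_assoc (h : RowRel q p x y x' y') (z : A) : y * (y' * z) = p • (y' * (y * z)) := by
  rw [← mul_assoc, h.yy, smul_mul_assoc, mul_assoc]

theorem xy'_assoc (h : RowRel q p x y x' y') (z : A) :
    x * (y' * z) = y' * (x * z) + (p - q) • (y * (x' * z)) := by
  rw [← mul_assoc, h.xy', add_mul, smul_mul_assoc, mul_assoc, mul_assoc]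

theorem x'y_assoc (h : RowRel q p x y x' y') (z : A) : x' * (y * z) = y * (x' * z) := by
  rw [← mul_assoc, h.x'y, mul_assoc]

end RowRel

/-- The quantum minor on two rows. -/
def minor (p : K) (x y x' y' : A) : A := x * y' - p • (y * x')

variable {q p : K} {x₁ y₁ x₂ y₂ x₃ y₃ x₄ y₄ : A}

theorem mul_assoc_of_eq {x y : A} {c : K} (h : x * y = c • (y * x)) (z : A) :
    x * (y * z) = c • (y * (x * z)) := by
  rw [← mul_assoc, h, smul_mul_assoc, mul_assoc]

/-- The normally ordered form of the minor: every `y` stands to the left of every `x`. -/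
theorem minor_eq (h : RowRel q p x₁ y₁ x₂ y₂) :
    minor p x₁ y₁ x₂ y₂ = y₂ * x₁ - q • (y₁ * x₂) := by
  rw [minor, h.xy']
  module

/-- This and the following identities are checked by normal ordering. The relations, read from left
to right, move each `y` to the left of each `x` and, among equal letters, the lower row to the left.
Both sides become combinations of the same words, and the coefficients agree because `q * p = 1`. No
associated form of `xx` is needed, as two letters `x` end the ordered word. -/
theorem minor_comm_left (hqp : q * p = 1)
    (h12 : RowRel q p x₁ y₁ x₂ y₂)
    (h13 : RowRel q p x₁ y₁ x₃ y₃)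
    (h23 : RowRel q p x₂ y₂ x₃ y₃)
    (h1 : x₁ * y₁ = p • (y₁ * x₁)) :
    minor p x₁ y₁ x₂ y₂ * minor p x₁ y₁ x₃ y₃ =
      p • (minor p x₁ y₁ x₃ y₃ * minor p x₁ y₁ x₂ y₂) := by
  have h1' := mul_assoc_of_eq h1
  simp only [minor_eq h12, minor_eq h13, mul_sub, sub_mul, mul_add, add_mul, smul_mul_assoc,
    mul_smul_comm, mul_assoc,
    h12.xx, h12.yy, h12.yy_assoc, h12.xy', h12.xy'_assoc, h12.x'y, h12.x'y_assoc,
    h13.xx, h13.yy, h13.yy_assoc, h13.xy', h13.xy'_assoc, h13.x'y, h13.x'y_assoc,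
    h23.xx, h23.yy, h23.yy_assoc, h23.xy', h23.xy'_assoc, h23.x'y, h23.x'y_assoc,
    h1, h1',
    smul_sub, smul_add, smul_neg, smul_smul, mul_neg, neg_mul, mul_zero, smul_zero]
  clear h12 h13 h23 h1 h1'
  match_scalars <;> grind

theorem minor_comm_middle (hqp : q * p = 1)
    (h12 : RowRel q p x₁ y₁ x₂ y₂)
    (h13 : RowRel q p x₁ y₁ x₃ y₃)
    (h23 : RowRel q p x₂ y₂ x₃ y₃)
    (h2 : x₂ * y₂ = p • (y₂ * x₂)) :
    minor p x₁ y₁ x₂ y₂ * minor p x₂ y₂ x₃ y₃ =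
      p • (minor p x₂ y₂ x₃ y₃ * minor p x₁ y₁ x₂ y₂) := by
  have h2' := mul_assoc_of_eq h2
  simp only [minor_eq h12, minor_eq h23, mul_sub, sub_mul, mul_add, add_mul, smul_mul_assoc,
    mul_smul_comm, mul_assoc,
    h12.xx, h12.yy, h12.yy_assoc, h12.xy', h12.xy'_assoc, h12.x'y, h12.x'y_assoc,
    h13.xx, h13.yy, h13.yy_assoc, h13.xy', h13.xy'_assoc, h13.x'y, h13.x'y_assoc,
    h23.xx, h23.yy, h23.yy_assoc, h23.xy', h23.xy'_assoc, h23.x'y, h23.x'y_assoc,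
    h2, h2',
    smul_sub, smul_add, smul_neg, smul_smul, mul_neg, neg_mul, mul_zero, smul_zero]
  clear h12 h13 h23 h2 h2'
  match_scalars <;> grind

theorem minor_comm_right (hqp : q * p = 1)
    (h12 : RowRel q p x₁ y₁ x₂ y₂)
    (h13 : RowRel q p x₁ y₁ x₃ y₃)
    (h23 : RowRel q p x₂ y₂ x₃ y₃)
    (h3 : x₃ * y₃ = p • (y₃ * x₃)) :
    minor p x₁ y₁ x₃ y₃ * minor p x₂ y₂ x₃ y₃ =
      p • (minor p x₂ y₂ x₃ y₃ * minor p x₁ y₁ x₃ y₃) := by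
  have h3' := mul_assoc_of_eq h3
  simp only [minor_eq h13, minor_eq h23, mul_sub, sub_mul, mul_add, add_mul, smul_mul_assoc,
    mul_smul_comm, mul_assoc,
    h12.xx, h12.yy, h12.yy_assoc, h12.xy', h12.xy'_assoc, h12.x'y, h12.x'y_assoc,
    h13.xx, h13.yy, h13.yy_assoc, h13.xy', h13.xy'_assoc, h13.x'y, h13.x'y_assoc,
    h23.xx, h23.yy, h23.yy_assoc, h23.xy', h23.xy'_assoc, h23.x'y, h23.x'y_assoc,
    h3, h3',
    smul_sub, smul_add, smul_neg, smul_smul, mul_neg, neg_mul, mul_zero, smul_zero]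
  clear h12 h13 h23 h3 h3'
  match_scalars <;> grind

theorem minor_comm_disjoint (hqp : q * p = 1)
    (h12 : RowRel q p x₁ y₁ x₂ y₂)
    (h13 : RowRel q p x₁ y₁ x₃ y₃)
    (h14 : RowRel q p x₁ y₁ x₄ y₄)
    (h23 : RowRel q p x₂ y₂ x₃ y₃)
    (h24 : RowRel q p x₂ y₂ x₄ y₄)
    (h34 : RowRel q p x₃ y₃ x₄ y₄) :
    minor p x₁ y₁ x₂ y₂ * minor p x₃ y₃ x₄ y₄ =
      (p * p) • (minor p x₃ y₃ x₄ y₄ * minor p x₁ y₁ x₂ y₂) := by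
  simp only [minor_eq h12, minor_eq h34, mul_sub, sub_mul, mul_add, add_mul, smul_mul_assoc,
    mul_smul_comm, mul_assoc,
    h12.xx, h12.yy, h12.yy_assoc, h12.xy', h12.xy'_assoc, h12.x'y, h12.x'y_assoc,
    h13.xx, h13.yy, h13.yy_assoc, h13.xy', h13.xy'_assoc, h13.x'y, h13.x'y_assoc,
    h14.xx, h14.yy, h14.yy_assoc, h14.xy', h14.xy'_assoc, h14.x'y, h14.x'y_assoc,
    h23.xx, h23.yy, h23.yy_assoc, h23.xy', h23.xy'_assoc, h23.x'y, h23.x'y_assoc,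
    h24.xx, h24.yy, h24.yy_assoc, h24.xy', h24.xy'_assoc, h24.x'y, h24.x'y_assoc,
    h34.xx, h34.yy, h34.yy_assoc, h34.xy', h34.xy'_assoc, h34.x'y, h34.x'y_assoc,
    smul_sub, smul_add, smul_neg, smul_smul, mul_neg, neg_mul, mul_zero, smul_zero]
  clear h12 h13 h14 h23 h24 h34
  match_scalars <;> grind

theorem minor_comm_crossing (hqp : q * p = 1)
    (h12 : RowRel q p x₁ y₁ x₂ y₂)
    (h13 : RowRel q p x₁ y₁ x₃ y₃)
    (h14 : RowRel q p x₁ y₁ x₄ y₄)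
    (h23 : RowRel q p x₂ y₂ x₃ y₃)
    (h24 : RowRel q p x₂ y₂ x₄ y₄)
    (h34 : RowRel q p x₃ y₃ x₄ y₄) :
    minor p x₁ y₁ x₃ y₃ * minor p x₂ y₂ x₄ y₄ =
      (p * p) • (minor p x₂ y₂ x₄ y₄ * minor p x₁ y₁ x₃ y₃) -
      (p - q) • (minor p x₁ y₁ x₂ y₂ * minor p x₃ y₃ x₄ y₄) := by
  simp only [minor_eq h13, minor_eq h24, minor_eq h12, minor_eq h34, mul_sub, sub_mul, mul_add,
    add_mul, smul_mul_assoc, mul_smul_comm, mul_assoc,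
    h12.xx, h12.yy, h12.yy_assoc, h12.xy', h12.xy'_assoc, h12.x'y, h12.x'y_assoc,
    h13.xx, h13.yy, h13.yy_assoc, h13.xy', h13.xy'_assoc, h13.x'y, h13.x'y_assoc,
    h14.xx, h14.yy, h14.yy_assoc, h14.xy', h14.xy'_assoc, h14.x'y, h14.x'y_assoc,
    h23.xx, h23.yy, h23.yy_assoc, h23.xy', h23.xy'_assoc, h23.x'y, h23.x'y_assoc,
    h24.xx, h24.yy, h24.yy_assoc, h24.xy', h24.xy'_assoc, h24.x'y, h24.x'y_assoc,
    h34.xx, h34.yy, h34.yy_assoc, h34.xy', h34.xy'_assoc, h34.x'y, h34.x'y_assoc,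
    smul_sub, smul_add, smul_neg, smul_smul, mul_neg, neg_mul, mul_zero, smul_zero]
  clear h12 h13 h14 h23 h24 h34
  match_scalars <;> grind

theorem minor_comm_nested (hqp : q * p = 1)
    (h12 : RowRel q p x₁ y₁ x₂ y₂)
    (h13 : RowRel q p x₁ y₁ x₃ y₃)
    (h14 : RowRel q p x₁ y₁ x₄ y₄)
    (h23 : RowRel q p x₂ y₂ x₃ y₃)
    (h24 : RowRel q p x₂ y₂ x₄ y₄)
    (h34 : RowRel q p x₃ y₃ x₄ y₄) :
    minor p x₁ y₁ x₄ y₄ * minor p x₂ y₂ x₃ y₃ =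
      minor p x₂ y₂ x₃ y₃ * minor p x₁ y₁ x₄ y₄ := by
  simp only [minor_eq h14, minor_eq h23, mul_sub, sub_mul, mul_add, add_mul, smul_mul_assoc,
    mul_smul_comm, mul_assoc,
    h12.xx, h12.yy, h12.yy_assoc, h12.xy', h12.xy'_assoc, h12.x'y, h12.x'y_assoc,
    h13.xx, h13.yy, h13.yy_assoc, h13.xy', h13.xy'_assoc, h13.x'y, h13.x'y_assoc,
    h14.xx, h14.yy, h14.yy_assoc, h14.xy', h14.xy'_assoc, h14.x'y, h14.x'y_assoc,
    h23.xx, h23.yy, h23.yy_assoc, h23.xy', h23.xy'_assoc, h23.x'y, h23.x'y_assoc,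
    h24.xx, h24.yy, h24.yy_assoc, h24.xy', h24.xy'_assoc, h24.x'y, h24.x'y_assoc,
    h34.xx, h34.yy, h34.yy_assoc, h34.xy', h34.xy'_assoc, h34.x'y, h34.x'y_assoc,
    smul_sub, smul_add, smul_neg, smul_smul, mul_neg, neg_mul, mul_zero, smul_zero]
  clear h12 h13 h14 h23 h24 h34
  match_scalars <;> grind

/-- No relation inside a single row enters, so the identity also covers a last row that is odd. -/
theorem minor_plucker (hqp : q * p = 1)
    (h12 : RowRel q p x₁ y₁ x₂ y₂)
    (h13 : RowRel q p x₁ y₁ x₃ y₃)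
    (h14 : RowRel q p x₁ y₁ x₄ y₄)
    (h23 : RowRel q p x₂ y₂ x₃ y₃)
    (h24 : RowRel q p x₂ y₂ x₄ y₄)
    (h34 : RowRel q p x₃ y₃ x₄ y₄) :
    minor p x₁ y₁ x₂ y₂ * minor p x₃ y₃ x₄ y₄ -
      p • (minor p x₁ y₁ x₃ y₃ * minor p x₂ y₂ x₄ y₄) +
      (p * p) • (minor p x₁ y₁ x₄ y₄ * minor p x₂ y₂ x₃ y₃) = 0 := by
  simp only [minor_eq h12, minor_eq h34, minor_eq h13, minor_eq h24, minor_eq h14, minor_eq h23,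
    mul_sub, sub_mul, mul_add, add_mul, smul_mul_assoc, mul_smul_comm, mul_assoc,
    h12.xx, h12.yy, h12.yy_assoc, h12.xy', h12.xy'_assoc, h12.x'y, h12.x'y_assoc,
    h13.xx, h13.yy, h13.yy_assoc, h13.xy', h13.xy'_assoc, h13.x'y, h13.x'y_assoc,
    h14.xx, h14.yy, h14.yy_assoc, h14.xy', h14.xy'_assoc, h14.x'y, h14.x'y_assoc,
    h23.xx, h23.yy, h23.yy_assoc, h23.xy', h23.xy'_assoc, h23.x'y, h23.x'y_assoc,
    h24.xx, h24.yy, h24.yy_assoc, h24.xy', h24.xy'_assoc, h24.x'y, h24.x'y_assoc,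
    h34.xx, h34.yy, h34.yy_assoc, h34.xy', h34.xy'_assoc, h34.x'y, h34.x'y_assoc,
    smul_sub, smul_add, smul_neg, smul_smul, mul_neg, neg_mul, mul_zero, smul_zero]
  clear h12 h13 h14 h23 h24 h34
  match_scalars <;> grind

/-- From here on the third row is the odd one: its entries square to zero and commute up to `-q` in
place of `p`. -/
theorem minor_comm_odd_sq (h12 : RowRel q p x₁ y₁ x₂ y₂)
    (h13 : RowRel q p x₁ y₁ x₃ y₃)
    (h23 : RowRel q p x₂ y₂ x₃ y₃)
    (hx : x₃ * x₃ = 0) (hy : y₃ * y₃ = 0) (h3 : x₃ * y₃ = (-q) • (y₃ * x₃)) :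
    minor p x₁ y₁ x₂ y₂ * (x₃ * y₃) =
      (p * p) • ((x₃ * y₃) * minor p x₁ y₁ x₂ y₂) := by
  have hx' (z : A) : x₃ * (x₃ * z) = 0 := by rw [← mul_assoc, hx, zero_mul]
  have hy' (z : A) : y₃ * (y₃ * z) = 0 := by rw [← mul_assoc, hy, zero_mul]
  have h3' := mul_assoc_of_eq h3
  simp only [minor_eq h12, mul_sub, sub_mul, mul_add, add_mul, smul_mul_assoc, mul_smul_comm,
    mul_assoc,
    h12.xx, h12.yy, h12.yy_assoc, h12.xy', h12.xy'_assoc, h12.x'y, h12.x'y_assoc,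
    h13.xx, h13.yy, h13.yy_assoc, h13.xy', h13.xy'_assoc, h13.x'y, h13.x'y_assoc,
    h23.xx, h23.yy, h23.yy_assoc, h23.xy', h23.xy'_assoc, h23.x'y, h23.x'y_assoc,
    hx, hx', hy, hy', h3, h3',
    smul_sub, smul_add, smul_neg, smul_smul, mul_neg, neg_mul, mul_zero, smul_zero]
  clear h12 h13 h23 hx hx' hy hy' h3 h3'
  match_scalars <;> grind

theorem minor_odd_mul_minor_odd (hqp : q * p = 1)
    (h12 : RowRel q p x₁ y₁ x₂ y₂)
    (h13 : RowRel q p x₁ y₁ x₃ y₃)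
    (h23 : RowRel q p x₂ y₂ x₃ y₃)
    (hx : x₃ * x₃ = 0) (hy : y₃ * y₃ = 0) (h3 : x₃ * y₃ = (-q) • (y₃ * x₃)) :
    minor p x₁ y₁ x₃ y₃ * minor p x₂ y₂ x₃ y₃ =
      q • (minor p x₁ y₁ x₂ y₂ * (x₃ * y₃)) := by
  have hx' (z : A) : x₃ * (x₃ * z) = 0 := by rw [← mul_assoc, hx, zero_mul]
  have hy' (z : A) : y₃ * (y₃ * z) = 0 := by rw [← mul_assoc, hy, zero_mul]
  have h3' := mul_assoc_of_eq h3
  simp only [minor_eq h12, minor_eq h13, minor_eq h23, mul_sub, sub_mul, mul_add, add_mul,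
    smul_mul_assoc, mul_smul_comm, mul_assoc,
    h12.xx, h12.yy, h12.yy_assoc, h12.xy', h12.xy'_assoc, h12.x'y, h12.x'y_assoc,
    h13.xx, h13.yy, h13.yy_assoc, h13.xy', h13.xy'_assoc, h13.x'y, h13.x'y_assoc,
    h23.xx, h23.yy, h23.yy_assoc, h23.xy', h23.xy'_assoc, h23.x'y, h23.x'y_assoc,
    hx, hx', hy, hy', h3, h3',
    smul_sub, smul_add, smul_neg, smul_smul, mul_neg, neg_mul, mul_zero, smul_zero]
  clear h12 h13 h23 hx hx' hy hy' h3 h3'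
  match_scalars <;> grind

theorem minor_comm_odd_odd (hqp : q * p = 1)
    (h12 : RowRel q p x₁ y₁ x₂ y₂)
    (h13 : RowRel q p x₁ y₁ x₃ y₃)
    (h23 : RowRel q p x₂ y₂ x₃ y₃)
    (hx : x₃ * x₃ = 0) (hy : y₃ * y₃ = 0) (h3 : x₃ * y₃ = (-q) • (y₃ * x₃)) :
    minor p x₁ y₁ x₃ y₃ * minor p x₂ y₂ x₃ y₃ =
      -(p • (minor p x₂ y₂ x₃ y₃ * minor p x₁ y₁ x₃ y₃)) - (p - q) • (minor p x₁ y₁ x₂ y₂ *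
        (x₃ * y₃)) := by
  have hx' (z : A) : x₃ * (x₃ * z) = 0 := by rw [← mul_assoc, hx, zero_mul]
  have hy' (z : A) : y₃ * (y₃ * z) = 0 := by rw [← mul_assoc, hy, zero_mul]
  have h3' := mul_assoc_of_eq h3
  simp only [minor_eq h12, minor_eq h13, minor_eq h23, mul_sub, sub_mul, mul_add, add_mul,
    smul_mul_assoc, mul_smul_comm, mul_assoc,
    h12.xx, h12.yy, h12.yy_assoc, h12.xy', h12.xy'_assoc, h12.x'y, h12.x'y_assoc,
    h13.xx, h13.yy, h13.yy_assoc, h13.xy', h13.xy'_assoc, h13.x'y, h13.x'y_assoc,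
    h23.xx, h23.yy, h23.yy_assoc, h23.xy', h23.xy'_assoc, h23.x'y, h23.x'y_assoc,
    hx, hx', hy, hy', h3, h3',
    smul_sub, smul_add, smul_neg, smul_smul, mul_neg, neg_mul, mul_zero, smul_zero]
  clear h12 h13 h23 hx hx' hy hy' h3 h3'
  match_scalars <;> grind

theorem minor_odd_mul_odd_sq (h13 : RowRel q p x₁ y₁ x₃ y₃)
    (hx : x₃ * x₃ = 0) (hy : y₃ * y₃ = 0) (h3 : x₃ * y₃ = (-q) • (y₃ * x₃)) :
    minor p x₁ y₁ x₃ y₃ * (x₃ * y₃) = 0 := by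
  have hx' (z : A) : x₃ * (x₃ * z) = 0 := by rw [← mul_assoc, hx, zero_mul]
  have hy' (z : A) : y₃ * (y₃ * z) = 0 := by rw [← mul_assoc, hy, zero_mul]
  have h3' := mul_assoc_of_eq h3
  simp only [minor_eq h13, mul_sub, sub_mul, mul_add, add_mul, smul_mul_assoc, mul_smul_comm,
    mul_assoc,
    h13.xx, h13.yy, h13.yy_assoc, h13.xy', h13.xy'_assoc, h13.x'y, h13.x'y_assoc,
    hx, hx', hy, hy', h3, h3',
    smul_sub, smul_add, smul_neg, smul_smul, mul_neg, neg_mul, mul_zero, smul_zero]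
  clear h13 hx hx' hy hy' h3 h3'
  match_scalars

theorem odd_sq_mul_minor_odd (h13 : RowRel q p x₁ y₁ x₃ y₃)
    (hx : x₃ * x₃ = 0) (hy : y₃ * y₃ = 0) (h3 : x₃ * y₃ = (-q) • (y₃ * x₃)) :
    (x₃ * y₃) * minor p x₁ y₁ x₃ y₃ = 0 := by
  have hx' (z : A) : x₃ * (x₃ * z) = 0 := by rw [← mul_assoc, hx, zero_mul]
  have hy' (z : A) : y₃ * (y₃ * z) = 0 := by rw [← mul_assoc, hy, zero_mul]
  have h3' := mul_assoc_of_eq h3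
  simp only [minor_eq h13, mul_sub, sub_mul, mul_add, add_mul, smul_mul_assoc, mul_smul_comm,
    mul_assoc,
    h13.xx, h13.yy, h13.yy_assoc, h13.xy', h13.xy'_assoc, h13.x'y, h13.x'y_assoc,
    hx, hx', hy, hy', h3, h3',
    smul_sub, smul_add, smul_neg, smul_smul, mul_neg, neg_mul, mul_zero, smul_zero]
  clear h13 hx hx' hy hy' h3 h3'
  match_scalars

theorem minor_odd_mul_self (hqp : q * p = 1)
    (h13 : RowRel q p x₁ y₁ x₃ y₃)
    (hx : x₃ * x₃ = 0) (hy : y₃ * y₃ = 0) (h3 : x₃ * y₃ = (-q) • (y₃ * x₃))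
    (h1 : x₁ * y₁ = p • (y₁ * x₁)) :
    minor p x₁ y₁ x₃ y₃ * minor p x₁ y₁ x₃ y₃ = 0 := by
  have hx' (z : A) : x₃ * (x₃ * z) = 0 := by rw [← mul_assoc, hx, zero_mul]
  have hy' (z : A) : y₃ * (y₃ * z) = 0 := by rw [← mul_assoc, hy, zero_mul]
  have h3' := mul_assoc_of_eq h3
  have h1' := mul_assoc_of_eq h1
  simp only [minor_eq h13, mul_sub, sub_mul, mul_add, add_mul, smul_mul_assoc, mul_smul_comm,
    mul_assoc,
    h13.xx, h13.yy, h13.yy_assoc, h13.xy', h13.xy'_assoc, h13.x'y, h13.x'y_assoc,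
    hx, hx', hy, hy', h3, h3', h1, h1',
    smul_sub, smul_add, smul_neg, smul_smul, mul_neg, neg_mul, mul_zero, smul_zero]
  clear h13 hx hx' hy hy' h3 h3' h1 h1'
  match_scalars
  grind

end Minors

end QuantumGr

namespace QuantumGr

/-! ### The relations between quantum super minors -/

theorem qpow_mul (a b : ℤ) : qpow a * qpow b = qpow (a + b) := (LaurentPolynomial.T_add a b).symm

theorem qpow_zero : qpow 0 = 1 := LaurentPolynomial.T_zero

theorem qpow_one_mul_neg_one : qpow 1 * qpow (-1) = 1 := by
  rw [qpow_mul, add_neg_cancel, qpow_zero]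

theorem qpow_neg_one_mul_self : qpow (-1) * qpow (-1) = qpow (-2) := by
  rw [qpow_mul]; norm_num

theorem mkAlgHom_entryHom_fa (m n : ℕ) (i j : Fin (m + n)) :
    RingQuot.mkAlgHom Cq (GLqRel m n) (entryHom m n (fa m n i j)) = entry m n i j := by
  simp [fa, entryHom, entry]

theorem entry_rel {m n : ℕ} {x y : FreeAlgebra Cq (Fin (m + n) × Fin (m + n))}
    (h : MqRel m n x y) :
    RingQuot.mkAlgHom Cq (GLqRel m n) (entryHom m n x) =
      RingQuot.mkAlgHom Cq (GLqRel m n) (entryHom m n y) :=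
  RingQuot.mkAlgHom_rel Cq (GLqRel.mat h)

section GenericRelations

variable {m n : ℕ}

theorem entry_row (i j l : Fin (m + n)) (h : j < l) :
    entry m n i j * entry m n i l =
      (entrySign m n i j i l * qIdx m n i) • (entry m n i l * entry m n i j) := by
  simpa [mkAlgHom_entryHom_fa] using entry_rel (MqRel.row i j l h)

theorem entry_col (i k j : Fin (m + n)) (h : i < k) :
    entry m n i j * entry m n k j =
      (entrySign m n i j k j * qIdx m n j) • (entry m n k j * entry m n i j) := by
  simpa [mkAlgHom_entryHom_fa] using entry_rel (MqRel.col i k j h)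

theorem entry_anti (i j k l : Fin (m + n)) (h : (i < k ∧ l < j) ∨ (k < i ∧ j < l)) :
    entry m n i j * entry m n k l = entrySign m n i j k l • (entry m n k l * entry m n i j) := by
  simpa [mkAlgHom_entryHom_fa] using entry_rel (MqRel.anti i j k l h)

theorem entry_diag (i j k l : Fin (m + n)) (hik : i < k) (hjl : j < l) :
    entry m n i j * entry m n k l - entrySign m n i j k l • (entry m n k l * entry m n i j) =
      (entrySign m n i j k j * (qpow (-1) - qpow 1)) • (entry m n k j * entry m n i l) := by
  simpa [mkAlgHom_entryHom_fa] using entry_rel (MqRel.diag i j k l hik hjl)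

theorem entry_oddSq (i j : Fin (m + n)) (h : entryParity m n i j = 1) :
    entry m n i j * entry m n i j = 0 := by
  simpa [mkAlgHom_entryHom_fa] using entry_rel (MqRel.oddSq i j h)

end GenericRelations

/-! ### Manin's relations in the first two columns of `GL_q(4|1)`. -/

theorem idxParity_of_lt {i : Fin 5} (h : i < 4) : idxParity 4 1 i = 0 := by
  have : (i : ℕ) < 4 := h
  simp [idxParity, this]

theorem idxParity_zero : idxParity 4 1 0 = 0 := rfl

theorem idxParity_one : idxParity 4 1 1 = 0 := rfl

theorem idxParity_four : idxParity 4 1 4 = 1 := rfl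

theorem lt_four_of_lt {i k : Fin 5} (h : i < k) : i < 4 := by omega

/-- The upper row is always even, so its entries in columns `0` and `1` are even and all signs
disappear. Hence the odd row satisfies the same relations with the rows above it as an even one; its
oddness is felt only inside the row. -/
theorem entry_rowRel {i k : Fin 5} (h : i < k) :
    RowRel (qpow 1) (qpow (-1)) (entry 4 1 i 0) (entry 4 1 i 1)
      (entry 4 1 k 0) (entry 4 1 k 1) := by
  have hi := idxParity_of_lt (lt_four_of_lt h)
  have h2 := entry_anti (m := 4) (n := 1) k 0 i 1 (Or.inr ⟨h, by decide⟩)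
  simp only [entrySign, entryParity, hi, idxParity_zero, idxParity_one,
    add_zero, mul_zero, pow_zero, one_smul] at h2
  constructor
  · simpa [entrySign, entryParity, qIdx, hi, idxParity_zero] using
      entry_col (m := 4) (n := 1) i k 0 h
  · simpa [entrySign, entryParity, qIdx, hi, idxParity_one] using
      entry_col (m := 4) (n := 1) i k 1 h
  · have := entry_diag (m := 4) (n := 1) i 0 k 1 h (by decide)
    simp only [entrySign, entryParity, hi, idxParity_zero, idxParity_one,
      add_zero, zero_mul, pow_zero, one_smul, one_mul, h2] at this
    rw [← this]
    abel
  · exact h2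

theorem entry_row_even {i : Fin 5} (h : i < 4) :
    entry 4 1 i 0 * entry 4 1 i 1 = qpow (-1) • (entry 4 1 i 1 * entry 4 1 i 0) := by
  simpa [entrySign, entryParity, qIdx, idxParity_of_lt h, idxParity_zero, idxParity_one] using
      entry_row (m := 4) (n := 1) i 0 1 (by decide)

theorem entry_row_odd :
    entry 4 1 4 0 * entry 4 1 4 1 = (-qpow 1) • (entry 4 1 4 1 * entry 4 1 4 0) := by
  simpa [entrySign, entryParity, qIdx, idxParity_four, idxParity_zero, idxParity_one] using
      entry_row (m := 4) (n := 1) 4 0 1 (by decide)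

theorem entry_sq_zero {j : Fin 5} (h : j < 4) : entry 4 1 4 j * entry 4 1 4 j = 0 :=
  entry_oddSq (m := 4) (n := 1) 4 j (by rw [entryParity, idxParity_of_lt h, idxParity_four])

theorem qMinor_pair {i j : Fin 5} (h : i < j) :
    qMinor (PIdx.pair i j h) = minor (qpow (-1)) (entry 4 1 i 0) (entry 4 1 i 1)
      (entry 4 1 j 0) (entry 4 1 j 1) := rfl

/-- The evaluation `X_p ↦ D_p` of the free algebra in `GL_q(4|1)`. -/
noncomputable def evalMinors : FreeAlgebra Cq PIdx →ₐ[Cq] GLq 4 1 := FreeAlgebra.lift Cq qMinor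

theorem evalMinors_X {i j : Fin 5} (h : i < j) :
    evalMinors (X i j h) = minor (qpow (-1)) (entry 4 1 i 0) (entry 4 1 i 1)
      (entry 4 1 j 0) (entry 4 1 j 1) := by
  rw [← qMinor_pair h]
  simp [evalMinors, X]

theorem evalMinors_X55 : evalMinors X55 = entry 4 1 4 0 * entry 4 1 4 1 := by
  simp [evalMinors, X55, qMinor]

theorem evalMinors_rel {x y : FreeAlgebra Cq PIdx} (h : GrRel x y) :
    evalMinors x = evalMinors y := by
  have hq := qpow_one_mul_neg_one
  have h0 : (0 : Fin 5) < 4 := by decide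
  have h1 : (1 : Fin 5) < 4 := by decide
  induction h with
  | comm_overlap i j k l hij hkl hlex hcommon hodd =>
    simp only [map_mul, map_smul, evalMinors_X]
    by_cases hik : i = k
    · subst hik
      have hjl : j < l := by omega
      exact minor_comm_left hq (entry_rowRel hij) (entry_rowRel hkl) (entry_rowRel hjl)
        (entry_row_even (lt_four_of_lt hij))
    by_cases hjk : j = k
    · subst hjk
      exact minor_comm_middle hq (entry_rowRel hij) (entry_rowRel (hij.trans hkl))
        (entry_rowRel hkl) (entry_row_even (lt_four_of_lt hkl))
    -- The remaining possibility `i = l` is excluded by `i ≤ k < l`; the shared last index is then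
    -- even by `hodd`.
    have hjl : j = l := by omega
    subst hjl
    exact minor_comm_right hq (entry_rowRel (by omega)) (entry_rowRel hij)
      (entry_rowRel hkl) (entry_row_even (by omega))
  | comm_disjoint i j k l hij hjk hkl =>
    simp only [map_mul, map_smul, evalMinors_X, ← qpow_neg_one_mul_self]
    apply minor_comm_disjoint hq <;> apply entry_rowRel <;> omega
  | comm_crossing i k j l hik hkj hjl =>
    simp only [map_mul, map_smul, map_sub, evalMinors_X, ← qpow_neg_one_mul_self]
    apply minor_comm_crossing hq <;> apply entry_rowRel <;> omega
  | comm_nested i k l j hik hkl hlj =>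
    simp only [map_mul, evalMinors_X]
    apply minor_comm_nested hq <;> apply entry_rowRel <;> omega
  | comm_even_55 i j hij hj =>
    simp only [map_mul, map_smul, evalMinors_X, evalMinors_X55, ← qpow_neg_one_mul_self]
    exact minor_comm_odd_sq (entry_rowRel hij) (entry_rowRel (hij.trans hj)) (entry_rowRel hj)
      (entry_sq_zero h0) (entry_sq_zero h1) entry_row_odd
  | comm_odd_odd i j hij hj =>
    simp only [map_mul, map_smul, map_sub, map_neg, evalMinors_X, evalMinors_X55]
    exact minor_comm_odd_odd hq (entry_rowRel hij) (entry_rowRel (hij.trans hj)) (entry_rowRel hj)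
      (entry_sq_zero h0) (entry_sq_zero h1) entry_row_odd
  | odd_mul_55 i hi =>
    simp only [map_mul, map_zero, evalMinors_X, evalMinors_X55]
    exact minor_odd_mul_odd_sq (entry_rowRel hi) (entry_sq_zero h0) (entry_sq_zero h1)
      entry_row_odd
  | mul_55_odd i hi =>
    simp only [map_mul, map_zero, evalMinors_X, evalMinors_X55]
    exact odd_sq_mul_minor_odd (entry_rowRel hi) (entry_sq_zero h0) (entry_sq_zero h1)
      entry_row_odd
  | odd_sq i hi =>
    simp only [map_mul, map_zero, evalMinors_X]
    exact minor_odd_mul_self hq (entry_rowRel hi) (entry_sq_zero h0) (entry_sq_zero h1)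
      entry_row_odd (entry_row_even hi)
  | sq_55 =>
    simp only [map_mul, map_zero, evalMinors_X55]
    nth_rw 1 [entry_row_odd]
    rw [smul_mul_assoc, mul_assoc, ← mul_assoc (entry 4 1 4 0), entry_sq_zero h0, zero_mul,
      mul_zero, smul_zero]
  | plucker_even =>
    simp only [map_mul, map_smul, map_sub, map_add, map_zero, evalMinors_X, ← qpow_neg_one_mul_self]
    apply minor_plucker hq <;> apply entry_rowRel <;> decide
  | plucker_odd i j k hij hjk hk =>
    simp only [map_mul, map_smul, map_sub, map_add, map_zero, evalMinors_X, ← qpow_neg_one_mul_self]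
    apply minor_plucker hq <;> apply entry_rowRel <;> omega
  | plucker_55 i j hij hj =>
    simp only [map_mul, map_smul, evalMinors_X, evalMinors_X55]
    exact minor_odd_mul_minor_odd hq (entry_rowRel hij) (entry_rowRel (hij.trans hj))
      (entry_rowRel hj) (entry_sq_zero h0) (entry_sq_zero h1) entry_row_odd

/-- The algebra homomorphism `ℂ_q⟨X_ij⟩ / I_Gr → GL_q(4|1)`. -/
noncomputable def presentedToGLq : GrPresented →ₐ[Cq] GLq 4 1 :=
  RingQuot.liftAlgHom Cq ⟨evalMinors, fun _ _ h => evalMinors_rel h⟩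

theorem presentedToGLq_presGen (p : PIdx) : presentedToGLq (presGen p) = qMinor p := by
  simp [presentedToGLq, presGen, evalMinors]

end QuantumGr

namespace QuantumGr

/-! ### Straightening -/

theorem presented_rel {x y : FreeAlgebra Cq PIdx} (h : GrRel x y) :
    RingQuot.mkAlgHom Cq GrRel x = RingQuot.mkAlgHom Cq GrRel y :=
  RingQuot.mkAlgHom_rel Cq h

theorem mkAlgHom_X (i j : Fin 5) (h : i < j) :
    RingQuot.mkAlgHom Cq GrRel (X i j h) = presGen (PIdx.pair i j h) := rfl

theorem mkAlgHom_X55 : RingQuot.mkAlgHom Cq GrRel X55 = presGen PIdx.d55 := rfl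

/-- A numerical code for labels, increasing for the lexicographic order. -/
def PIdx.code (p : PIdx) : ℕ := 5 * p.fst + p.snd

theorem PIdx.code_lt (p : PIdx) : p.code < 25 := by
  have := p.fst.2
  have := p.snd.2
  unfold PIdx.code
  omega

/-- The span of the products of two generators the first of which precedes `p`. -/
noncomputable def smallerProducts (p : PIdx) : Submodule Cq GrPresented :=
  Submodule.span Cq {z | ∃ a b : PIdx, a.code < p.code ∧ z = presGen a * presGen b}

theorem mul_mem_smallerProducts {p a : PIdx} (b : PIdx) (h : a.code < p.code) :
    presGen a * presGen b ∈ smallerProducts p :=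
  Submodule.subset_span ⟨a, b, h, rfl⟩

theorem smul_eq_of_qpow_smul_eq {a b : ℤ} (hab : b + a = 0) {x y : GrPresented}
    (h : qpow a • x = y) : x = qpow b • y := by
  rw [← h, smul_smul, qpow_mul, hab, qpow_zero, one_smul]

/-- When the second label is lexicographically smaller, the commutation relation of the pair, read
backwards, puts it in front. Extra terms start with `(k, i)`, which is smaller because `k < i`. -/
theorem presGen_mul_mem_of_lex (i j k l : Fin 5) (hij : i < j) (hkl : k < l)
    (hlex : k < i ∨ (k = i ∧ l < j)) :
    presGen (PIdx.pair i j hij) * presGen (PIdx.pair k l hkl) ∈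
      smallerProducts (PIdx.pair i j hij) := by
  have hcode : ∀ (a b : Fin 5) (h : a < b), a < i ∨ (a = i ∧ b < j) →
      (PIdx.pair a b h).code < (PIdx.pair i j hij).code := by
    intro a b h h'
    simp only [PIdx.code, PIdx.fst, PIdx.snd]
    omega
  by_cases hodd : l = 4 ∧ j = 4
  · obtain ⟨rfl, rfl⟩ := hodd
    have hki : k < i := by omega
    have h1 := presented_rel (GrRel.comm_odd_odd k i hki hij)
    have h2 := presented_rel (GrRel.plucker_55 k i hki hij)
    simp only [map_mul, map_sub, map_neg, map_smul, mkAlgHom_X, mkAlgHom_X55] at h1 h2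
    -- The commutation relation still contains the product of odd generators in the other order;
    -- `plucker_55` eliminates it, and the coefficient `-q - (q⁻¹ - q)` equals `-q⁻¹`.
    have h3 : qpow (-1) • (presGen (PIdx.pair i 4 hij) * presGen (PIdx.pair k 4 hkl)) =
        (-qpow (-1)) • (presGen (PIdx.pair k i hki) * presGen PIdx.d55) := by
      rw [h2] at h1
      have h4 : qpow (-1) • (presGen (PIdx.pair i 4 hij) * presGen (PIdx.pair k 4 hkl)) =
        -(qpow 1 • (presGen (PIdx.pair k i hki) * presGen PIdx.d55)) -
        (qpow (-1) - qpow 1) • (presGen (PIdx.pair k i hki) * presGen PIdx.d55) := by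
        rw [h1]; abel
      rw [h4]
      module
    rw [smul_eq_of_qpow_smul_eq (b := 1) (by norm_num) h3]
    exact Submodule.smul_mem _ _ (Submodule.smul_mem _ _
      (mul_mem_smallerProducts _ (hcode _ _ _ (by omega))))
  by_cases hcommon : k = i ∨ k = j ∨ l = i ∨ l = j
  · have h1 := presented_rel (GrRel.comm_overlap k l i j hkl hij hlex hcommon hodd)
    simp only [map_mul, map_smul, mkAlgHom_X] at h1
    rw [smul_eq_of_qpow_smul_eq (b := 1) (by norm_num) h1.symm]
    exact Submodule.smul_mem _ _ (mul_mem_smallerProducts _ (hcode _ _ _ hlex))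
  have hki : k < i := by omega
  rcases lt_or_ge l i with hli | hil
  · have h1 := presented_rel (GrRel.comm_disjoint k l i j hkl hli hij)
    simp only [map_mul, map_smul, mkAlgHom_X] at h1
    rw [smul_eq_of_qpow_smul_eq (b := 2) (by norm_num) h1.symm]
    exact Submodule.smul_mem _ _ (mul_mem_smallerProducts _ (hcode _ _ _ hlex))
  have hil' : i < l := by omega
  rcases lt_or_ge l j with hlj | hjl
  · have h1 := presented_rel (GrRel.comm_crossing k i l j hki hil' hlj)
    simp only [map_mul, map_sub, map_smul, mkAlgHom_X] at h1
    have h2 : qpow (-2) • (presGen (PIdx.pair i j hij) * presGen (PIdx.pair k l hkl)) =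
        presGen (PIdx.pair k l hkl) * presGen (PIdx.pair i j hij) +
        (qpow (-1) - qpow 1) •
          (presGen (PIdx.pair k i hki) * presGen (PIdx.pair l j hlj)) := by
      rw [h1]; abel
    rw [smul_eq_of_qpow_smul_eq (b := 2) (by norm_num) h2]
    exact Submodule.smul_mem _ _ (Submodule.add_mem _
      (mul_mem_smallerProducts _ (hcode _ _ _ hlex))
      (Submodule.smul_mem _ _ (mul_mem_smallerProducts _ (hcode _ _ _ (by omega)))))
  · have h1 := presented_rel (GrRel.comm_nested k i j l hki hij (by omega))
    simp only [map_mul, mkAlgHom_X] at h1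
    rw [← h1]
    exact mul_mem_smallerProducts _ (hcode _ _ _ hlex)

/-- The Plücker relation on `i < k < l < j` is solved for its nested term; the other two terms start
with `(i, k)` and `(i, l)`, both smaller than `(i, j)`. -/
theorem presGen_mul_mem_of_nested (i j k l : Fin 5) (hij : i < j) (hkl : k < l)
    (hik : i < k) (hlj : l < j) :
    presGen (PIdx.pair i j hij) * presGen (PIdx.pair k l hkl) ∈
      smallerProducts (PIdx.pair i j hij) := by
  have hcode : ∀ (b : Fin 5) (h : i < b), b < j →
      (PIdx.pair i b h).code < (PIdx.pair i j hij).code := by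
    intro b h h'
    simp only [PIdx.code, PIdx.fst, PIdx.snd]
    omega
  have key : ∀ a b c : GrPresented, a - qpow (-1) • b + qpow (-2) • c = 0 →
      a ∈ smallerProducts (PIdx.pair i j hij) → b ∈ smallerProducts (PIdx.pair i j hij) →
      c ∈ smallerProducts (PIdx.pair i j hij) := by
    intro a b c h ha hb
    have h2 : qpow (-2) • c = qpow (-1) • b + (-1 : Cq) • a := by
      rw [← add_zero (qpow (-1) • b + (-1 : Cq) • a), ← h]; module
    rw [smul_eq_of_qpow_smul_eq (b := 2) (by norm_num) h2]
    exact Submodule.smul_mem _ _ (Submodule.add_mem _ (Submodule.smul_mem _ _ hb)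
      (Submodule.smul_mem _ _ ha))
  by_cases hj : j = 4
  · subst hj
    have h1 := presented_rel (GrRel.plucker_odd i k l hik hkl hlj)
    simp only [map_mul, map_sub, map_add, map_smul, map_zero, mkAlgHom_X] at h1
    exact key _ _ _ h1 (mul_mem_smallerProducts _ (hcode _ _ (by omega)))
      (mul_mem_smallerProducts _ (hcode _ _ (by omega)))
  · obtain rfl : i = 0 := by omega
    obtain rfl : k = 1 := by omega
    obtain rfl : l = 2 := by omega
    obtain rfl : j = 3 := by omega
    have h1 := presented_rel GrRel.plucker_even
    simp only [map_mul, map_sub, map_add, map_smul, map_zero, mkAlgHom_X] at h1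
    exact key _ _ _ h1 (mul_mem_smallerProducts _ (hcode _ _ (by omega)))
      (mul_mem_smallerProducts _ (hcode _ _ (by omega)))

theorem presGen_mul_mem_smallerProducts (p r : PIdx) (h : ¬ RowAbove p r) :
    presGen p * presGen r ∈ smallerProducts p := by
  rcases p with ⟨i, j, hij⟩ | _ <;> rcases r with ⟨k, l, hkl⟩ | _
  · simp only [RowAbove, PIdx.fst, PIdx.snd] at h
    by_cases hlex : k < i ∨ (k = i ∧ l < j)
    · exact presGen_mul_mem_of_lex i j k l hij hkl hlex
    by_cases hnest : i < k ∧ l < j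
    · exact presGen_mul_mem_of_nested i j k l hij hkl hnest.1 hnest.2
    -- Both columns now increase weakly and first entries of pairs are even, so the only obstruction
    -- left is a repeated odd index in the second column.
    obtain rfl : j = 4 := by omega
    obtain rfl : l = 4 := by omega
    by_cases hik : i = k
    · subst hik
      have h1 := presented_rel (GrRel.odd_sq i hij)
      simp only [map_mul, map_zero, mkAlgHom_X] at h1
      rw [h1]
      exact Submodule.zero_mem _
    · have hik' : i < k := by omega
      have h1 := presented_rel (GrRel.plucker_55 i k hik' hkl)
      simp only [map_mul, map_smul, mkAlgHom_X, mkAlgHom_X55] at h1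
      rw [h1]
      refine Submodule.smul_mem _ _ (mul_mem_smallerProducts _ ?_)
      simp only [PIdx.code, PIdx.fst, PIdx.snd]
      omega
  · simp only [RowAbove, PIdx.fst, PIdx.snd] at h
    obtain rfl : j = 4 := by omega
    have h1 := presented_rel (GrRel.odd_mul_55 i hij)
    simp only [map_mul, map_zero, mkAlgHom_X, mkAlgHom_X55] at h1
    rw [h1]
    exact Submodule.zero_mem _
  · by_cases hl : l = 4
    · subst hl
      have h1 := presented_rel (GrRel.mul_55_odd k hkl)
      simp only [map_mul, map_zero, mkAlgHom_X, mkAlgHom_X55] at h1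
      rw [h1]
      exact Submodule.zero_mem _
    · have h1 := presented_rel (GrRel.comm_even_55 k l hkl (by omega))
      simp only [map_mul, map_smul, mkAlgHom_X, mkAlgHom_X55] at h1
      rw [smul_eq_of_qpow_smul_eq (b := 2) (by norm_num) h1.symm]
      refine Submodule.smul_mem _ _ (mul_mem_smallerProducts _ ?_)
      simp only [PIdx.code, PIdx.fst, PIdx.snd]
      omega
  · have h1 := presented_rel GrRel.sq_55
    simp only [map_mul, map_zero, mkAlgHom_X55] at h1
    rw [h1]
    exact Submodule.zero_mem _

/-- A numerical code for words, increasing for the lexicographic order on words of a given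
length. -/
def wordCode : List PIdx → ℕ
  | [] => 0
  | p :: w => p.code * 25 ^ w.length + wordCode w

theorem wordCode_lt (w : List PIdx) : wordCode w < 25 ^ w.length := by
  induction w with
  | nil => simp [wordCode]
  | cons p w ih =>
    rw [wordCode, List.length_cons, pow_succ]
    nlinarith [p.code_lt]

/-- Codes are digits in base 25 and the length is unchanged, so lowering the digit of `p` outweighs
any change in the later digits. -/
theorem wordCode_append_lt (u : List PIdx) {a p : PIdx} (b r : PIdx) (v : List PIdx)
    (h : a.code < p.code) : wordCode (u ++ a :: b :: v) < wordCode (u ++ p :: r :: v) := by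
  induction u with
  | nil =>
    have := wordCode_lt (b :: v)
    have h2 := Nat.mul_le_mul_right (25 ^ (b :: v).length) (Nat.succ_le_of_lt h)
    have h3 : wordCode (a :: b :: v) = a.code * 25 ^ (b :: v).length + wordCode (b :: v) := rfl
    have h4 : wordCode (p :: r :: v) = p.code * 25 ^ (b :: v).length + wordCode (r :: v) := rfl
    rw [Nat.succ_mul] at h2
    rw [List.nil_append, List.nil_append]
    omega
  | cons c u ih =>
    simp only [List.cons_append, wordCode, List.length_append, List.length_cons]
    omega

/-- The span of the semistandard monomials. -/
noncomputable def standardSpan : Submodule Cq GrPresented :=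
  Submodule.span Cq (Set.range fun t : Tableau => (t.1.map presGen).prod)

theorem word_mem_standardSpan (w : List PIdx) : (w.map presGen).prod ∈ standardSpan := by
  induction hn : wordCode w using Nat.strong_induction_on generalizing w with
  | _ n ih =>
  by_cases hw : w.IsChain RowAbove
  · exact Submodule.subset_span ⟨⟨w, hw⟩, rfl⟩
  · rw [List.isChain_iff_forall_rel_of_append_cons_cons] at hw
    push Not at hw
    obtain ⟨p, r, u, v, rfl, hbad⟩ := hw
    -- The straightening of the bad adjacent pair is carried into the word by multiplying with the
    -- rest of it on both sides.
    let f : GrPresented →ₗ[Cq] GrPresented :=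
      LinearMap.mulLeft Cq (u.map presGen).prod ∘ₗ LinearMap.mulRight Cq (v.map presGen).prod
    have hle : smallerProducts p ≤ standardSpan.comap f := by
      refine Submodule.span_le.2 ?_
      rintro _ ⟨a, b, hab, rfl⟩
      have := ih _ (hn ▸ wordCode_append_lt u b r v hab) _ rfl
      simpa [f, mul_assoc] using this
    have := hle (presGen_mul_mem_smallerProducts p r hbad)
    simpa [f, mul_assoc] using this

theorem standardSpan_eq_top : standardSpan = ⊤ := by
  refine eq_top_iff.2 fun z _ => ?_
  obtain ⟨y, rfl⟩ := RingQuot.mkAlgHom_surjective Cq GrRel z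
  have hy : y ∈ Algebra.adjoin Cq (Set.range (FreeAlgebra.ι Cq (X := PIdx))) := by
    rw [FreeAlgebra.adjoin_range_ι]; trivial
  rw [← Subalgebra.mem_toSubmodule, Algebra.adjoin_eq_span] at hy
  have hle : Submodule.span Cq
      (Submonoid.closure (Set.range (FreeAlgebra.ι Cq (X := PIdx))) : Set (FreeAlgebra Cq PIdx)) ≤
      standardSpan.comap (RingQuot.mkAlgHom Cq GrRel).toLinearMap := by
    refine Submodule.span_le.2 fun m hm => ?_
    obtain ⟨l, hl, rfl⟩ := Submonoid.exists_list_of_mem_closure hm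
    have : Nonempty PIdx := ⟨PIdx.d55⟩
    choose! g hg using hl
    have := word_mem_standardSpan (l.map g)
    have hl' : l = (l.map g).map (FreeAlgebra.ι Cq) := by
      rw [List.map_map]
      exact (List.map_id l).symm.trans (List.map_congr_left fun y hy => (hg y hy).symm)
    rw [SetLike.mem_coe, Submodule.mem_comap, hl', AlgHom.toLinearMap_apply, map_list_prod,
      List.map_map]
    exact this
  exact hle hy

end QuantumGr

namespace QuantumGr

/-! ### Manin's relations in R-matrix form -/

section RMatrix

variable {A : Type*} [Ring A] [Algebra Cq A]

/-- The parity of an index of `M_q(4|1)`. -/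
abbrev par (i : Fin 5) : ℕ := idxParity 4 1 i

/-- The sign `(-1) ^ n`. -/
noncomputable def sgn (n : ℕ) : Cq := (-1) ^ n

/-- The constant `q⁻¹ - q`. -/
noncomputable def lam : Cq := qpow (-1) - qpow 1

/-- The diagonal coefficients of the R-matrix. -/
noncomputable def rDiag (i k : Fin 5) : Cq := if i = k then qIdx 4 1 i else 1

/-- The off-diagonal coefficients of the R-matrix, up to the restriction on the indices. -/
noncomputable def rOff (i j k : Fin 5) : Cq :=
  lam * sgn (par i * par j + par j * par k + par k * par i)

/-- Manin's relations in R-matrix form. -/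
def IsRTT (t : Fin 5 → Fin 5 → A) : Prop :=
  ∀ i k j l : Fin 5,
    rDiag i k • (t i j * t k l) + (if k < i then rOff i j k else 0) • (t k j * t i l) =
      (sgn ((par i + par j) * (par k + par l)) * rDiag j l) • (t k l * t i j) +
        (if j < l then rOff i j k else 0) • (t k j * t i l)

theorem sgn_congr {a b : ℕ} (h : Even a ↔ Even b) : sgn a = sgn b := by
  by_cases ha : Even a
  · rw [sgn, sgn, ha.neg_one_pow, (h.1 ha).neg_one_pow]
  · have hb : ¬ Even b := fun hb => ha (h.2 hb)
    rw [sgn, sgn, (Nat.not_even_iff_odd.1 ha).neg_one_pow, (Nat.not_even_iff_odd.1 hb).neg_one_pow]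

theorem sgn_mul (a b : ℕ) : sgn a * sgn b = sgn (a + b) := (pow_add _ _ _).symm

/-- The entries of two matrices supercommute. -/
def SuperCommute (s t : Fin 5 → Fin 5 → A) : Prop :=
  ∀ a j k b : Fin 5,
    t a j * s k b = sgn ((par a + par j) * (par k + par b)) • (s k b * t a j)

/-- The product of two matrices. -/
def matMul (s t : Fin 5 → Fin 5 → A) (i j : Fin 5) : A := ∑ a, s i a * t a j

theorem matMul_mul_matMul {s t : Fin 5 → Fin 5 → A} (h : SuperCommute s t) (i j k l : Fin 5) :
    matMul s t i j * matMul s t k l =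
      ∑ a, ∑ b, sgn ((par a + par j) * (par k + par b)) • (s i a * s k b * (t a j * t b l)) := by
  simp only [matMul, Finset.sum_mul_sum]
  refine Finset.sum_congr rfl fun a _ => Finset.sum_congr rfl fun b _ => ?_
  rw [mul_assoc, ← mul_assoc (t a j), h a j k b, smul_mul_assoc, mul_smul_comm, mul_assoc,
    mul_assoc]

-- The identity has the form R T₁ T₂ = T₂ T₁ R, so R can be passed first through the two factors
-- from `s` and then through those from `t`. The supercommutation of the entries of `s` and `t`
-- separates these factors, and the sums `e1` and `e2` isolate the two sides of the identity for `s`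
-- and for `t`. The rest is a comparison of signs, which is a statement about parities.
set_option maxHeartbeats 1600000 in
theorem IsRTT.matMul {s t : Fin 5 → Fin 5 → A} (hs : IsRTT s) (ht : IsRTT t)
    (h : SuperCommute s t) : IsRTT (matMul s t) := by
  intro i k j l
  have e1 : rDiag i k • (QuantumGr.matMul s t i j * QuantumGr.matMul s t k l) +
      (if k < i then rOff i j k else 0) • (QuantumGr.matMul s t k j * QuantumGr.matMul s t i l) =
      ∑ a, ∑ b, sgn ((par a + par j) * (par k + par b)) •
        ((rDiag i k • (s i a * s k b) + (if k < i then rOff i a k else 0) • (s k a * s i b)) *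
          (t a j * t b l)) := by
    rw [matMul_mul_matMul h, matMul_mul_matMul h, Finset.smul_sum, Finset.smul_sum,
      ← Finset.sum_add_distrib]
    refine Finset.sum_congr rfl fun a _ => ?_
    rw [Finset.smul_sum, Finset.smul_sum, ← Finset.sum_add_distrib]
    refine Finset.sum_congr rfl fun b _ => ?_
    rw [add_mul (rDiag i k • _), smul_add, smul_mul_assoc, smul_mul_assoc, smul_smul,
      smul_smul, smul_smul, smul_smul, mul_comm (rDiag i k)]
    congr 2
    split_ifs
    · rw [rOff, rOff, mul_assoc, sgn_mul, mul_left_comm, sgn_mul]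
      congr 1
      apply sgn_congr
      simp only [Nat.even_add, Nat.even_mul]
      by_cases hi : Even (par i) <;> by_cases hj : Even (par j) <;> by_cases hk : Even (par k) <;>
        by_cases ha : Even (par a) <;> by_cases hb : Even (par b) <;>
          simp [hi, hj, hk, ha, hb]
    · simp
  have e2 : (sgn ((par i + par j) * (par k + par l)) * rDiag j l) •
        (QuantumGr.matMul s t k l * QuantumGr.matMul s t i j) +
        (if j < l then rOff i j k else 0) • (QuantumGr.matMul s t k j * QuantumGr.matMul s t i l) =
      ∑ a, ∑ b, sgn ((par i + par j) * (par k + par b)) •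
        ((s k b * s i a) * ((sgn ((par a + par j) * (par b + par l)) * rDiag j l) •
          (t b l * t a j) + (if j < l then rOff a j b else 0) • (t b j * t a l))) := by
    rw [matMul_mul_matMul h, matMul_mul_matMul h, Finset.smul_sum, Finset.smul_sum,
      ← Finset.sum_add_distrib]
    simp only [Finset.smul_sum, ← Finset.sum_add_distrib]
    rw [Finset.sum_comm]
    refine Finset.sum_congr rfl fun a _ => Finset.sum_congr rfl fun b _ => ?_
    rw [mul_add (s k b * s i a), smul_add, mul_smul_comm, mul_smul_comm, smul_smul, smul_smul,
      smul_smul, smul_smul]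
    congr 2
    · rw [mul_right_comm, sgn_mul, ← mul_assoc, sgn_mul]
      congr 1
      apply sgn_congr
      simp only [Nat.even_add, Nat.even_mul]
      by_cases hi : Even (par i) <;> by_cases hj : Even (par j) <;> by_cases hk : Even (par k) <;>
        by_cases ha : Even (par a) <;> by_cases hb : Even (par b) <;> by_cases hl : Even (par l) <;>
          simp [hi, hj, hk, ha, hb, hl]
    · split_ifs
      · rw [rOff, rOff, mul_assoc, sgn_mul, mul_left_comm, sgn_mul]
        congr 1
        apply sgn_congr
        simp only [Nat.even_add, Nat.even_mul]
        by_cases hi : Even (par i) <;> by_cases hj : Even (par j) <;> by_cases hk : Even (par k) <;>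
          by_cases ha : Even (par a) <;> by_cases hb : Even (par b) <;>
            simp [hi, hj, hk, ha, hb]
      · simp
  rw [e1, e2]
  -- Here the identity for `s` is applied, and in `e4` the one for `t`, backwards. Both outcomes
  -- share their diagonal term.
  have e3 : ∀ a b, sgn ((par a + par j) * (par k + par b)) •
        ((rDiag i k • (s i a * s k b) + (if k < i then rOff i a k else 0) • (s k a * s i b)) *
          (t a j * t b l)) =
      (sgn ((par i + par j) * (par k + par b)) * rDiag a b) •
        (s k b * s i a * (t a j * t b l)) +
      (if a < b then lam * sgn (par a * par b + (par j * par k + par j * par b + par i * par a +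
        par k * par i)) else 0) • (s k a * s i b * (t a j * t b l)) := by
    intro a b
    rw [hs i k a b, add_mul (_ • (s k b * s i a)), smul_add, smul_mul_assoc, smul_mul_assoc,
      smul_smul, smul_smul, ← mul_assoc (sgn _), sgn_mul]
    congr 2
    · congr 1
      apply sgn_congr
      simp only [Nat.even_add, Nat.even_mul]
      by_cases hi : Even (par i) <;> by_cases hj : Even (par j) <;> by_cases hk : Even (par k) <;>
        by_cases ha : Even (par a) <;> by_cases hb : Even (par b) <;>
          simp [hi, hj, hk, ha, hb]
    · split_ifs
      · rw [rOff, mul_left_comm, sgn_mul]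
        congr 1
        apply sgn_congr
        simp only [Nat.even_add, Nat.even_mul]
        by_cases hi : Even (par i) <;> by_cases hj : Even (par j) <;> by_cases hk : Even (par k) <;>
          by_cases ha : Even (par a) <;> by_cases hb : Even (par b) <;>
            simp [hi, hj, hk, ha, hb]
      · simp
  have e4 : ∀ a b, sgn ((par i + par j) * (par k + par b)) •
        ((s k b * s i a) * ((sgn ((par a + par j) * (par b + par l)) * rDiag j l) •
          (t b l * t a j) + (if j < l then rOff a j b else 0) • (t b j * t a l))) =
      (sgn ((par i + par j) * (par k + par b)) * rDiag a b) •
        (s k b * s i a * (t a j * t b l)) +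
      (if b < a then lam * sgn (par b * par a + (par j * par k + par j * par a + par i * par b +
        par k * par i)) else 0) • (s k b * s i a * (t b j * t a l)) := by
    intro a b
    rw [← ht a b j l, mul_add (s k b * s i a), smul_add, mul_smul_comm, mul_smul_comm,
      smul_smul, smul_smul]
    congr 2
    split_ifs
    · rw [rOff, mul_left_comm, sgn_mul]
      congr 1
      apply sgn_congr
      simp only [Nat.even_add, Nat.even_mul]
      by_cases hi : Even (par i) <;> by_cases hj : Even (par j) <;> by_cases hk : Even (par k) <;>
        by_cases ha : Even (par a) <;> by_cases hb : Even (par b) <;>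
          simp [hi, hj, hk, ha, hb]
    · simp
  simp_rw [e3, e4, Finset.sum_add_distrib]
  congr 1
  -- The off-diagonal terms agree after exchanging the names of the summation indices.
  rw [Finset.sum_comm]

end RMatrix

end QuantumGr

namespace QuantumGr

set_option linter.unusedSimpArgs false

/-! ### Equivalence of Manin's relations and the R-matrix form. -/

section Manin

variable {A : Type*} [Ring A] [Algebra Cq A]

/-- Manin's relations between the entries of a matrix. -/
structure IsManin (t : Fin 5 → Fin 5 → A) : Prop where
  row : ∀ i j l, j < l →
    t i j * t i l = (sgn ((par i + par j) * (par i + par l)) * qIdx 4 1 i) • (t i l * t i j)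
  col : ∀ i k j, i < k →
    t i j * t k j = (sgn ((par i + par j) * (par k + par j)) * qIdx 4 1 j) • (t k j * t i j)
  anti : ∀ i j k l, i < k → l < j →
    t i j * t k l = sgn ((par i + par j) * (par k + par l)) • (t k l * t i j)
  diag : ∀ i j k l, i < k → j < l →
    t i j * t k l = sgn ((par i + par j) * (par k + par l)) • (t k l * t i j) +
      (lam * sgn ((par i + par j) * (par k + par j))) • (t k j * t i l)
  oddSq : ∀ i j, par i + par j = 1 → t i j * t i j = 0

theorem qIdx_of_lt {i : Fin 5} (h : i < 4) : qIdx 4 1 i = qpow (-1) := by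
  simp [qIdx, idxParity_of_lt h]

theorem qIdx_four : qIdx 4 1 4 = qpow 1 := by
  simp [qIdx, idxParity_four]

theorem par_cases (i : Fin 5) :
    (i < 4 ∧ par i = 0 ∧ qIdx 4 1 i = qpow (-1)) ∨ (i = 4 ∧ par i = 1 ∧ qIdx 4 1 i = qpow 1) := by
  rcases lt_or_ge i 4 with h | h
  · exact Or.inl ⟨h, idxParity_of_lt h, qIdx_of_lt h⟩
  · obtain rfl : i = 4 := by omega
    exact Or.inr ⟨rfl, rfl, qIdx_four⟩

theorem sgn_zero : sgn 0 = 1 := pow_zero _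

theorem sgn_one : sgn 1 = -1 := pow_one _

theorem sgn_mul_self (a : ℕ) : sgn a * sgn a = 1 := by
  rw [sgn, ← mul_pow]; simp

theorem sgn_two : sgn 2 = 1 := by simp [sgn]

/-- Being followed by another index, `j` is even, and both sign exponents reduce to `par i * par k`.
-/
theorem rOff_of_lt {i j k l : Fin 5} (h : j < l) :
    rOff i j k = lam * sgn ((par i + par j) * (par k + par j)) := by
  have hj : par j = 0 := idxParity_of_lt (lt_four_of_lt h)
  rw [rOff, hj, mul_zero, zero_mul, zero_add, zero_add, mul_comm (par k), add_zero, add_zero]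

/-- The cases follow the order of the rows and of the columns. If exactly one of the two index pairs
coincides and an off-diagonal term is present, the claim is the quadratic (Hecke) relation for the
diagonal coefficient. If both coincide, even entries give a trivial identity and odd ones need
`oddSq`. -/
theorem IsManin.isRTT {t : Fin 5 → Fin 5 → A} (h : IsManin t) : IsRTT t := by
  have hq := qpow_one_mul_neg_one
  intro i k j l
  rcases lt_trichotomy i k with hik | rfl | hik
  · rw [if_neg hik.not_gt, zero_smul, add_zero, rDiag, if_neg hik.ne, one_smul]
    rcases lt_trichotomy j l with hjl | rfl | hjl
    · rw [if_pos hjl, h.diag i j k l hik hjl, rDiag, if_neg hjl.ne, mul_one, rOff_of_lt hjl]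
    · rw [if_neg (lt_irrefl _), zero_smul, add_zero, h.col i k j hik, rDiag, if_pos rfl]
    · rw [if_neg hjl.not_gt, zero_smul, add_zero, h.anti i j k l hik hjl, rDiag, if_neg hjl.ne',
        mul_one]
  · rw [if_neg (lt_irrefl _), zero_smul, add_zero]
    rcases lt_trichotomy j l with hjl | rfl | hjl
    · rw [if_pos hjl, h.row i j l hjl, rDiag, if_pos rfl, rDiag, if_neg hjl.ne, smul_smul,
        smul_smul, ← add_smul, rOff, lam]
      congr 1
      have hj := idxParity_of_lt (lt_four_of_lt hjl)
      rcases par_cases i with ⟨-, h1, h2⟩ | ⟨-, h1, h2⟩ <;> simp only [par] at h1 <;>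
        simp only [par, h1, h2, hj, mul_zero, zero_mul, add_zero, zero_add, mul_one, sgn_zero,
          sgn_one, one_mul]
      · linear_combination hq
      · linear_combination sgn (1 + idxParity 4 1 l) * hq
    · rw [if_neg (lt_irrefl _), zero_smul, add_zero, rDiag, rDiag, if_pos rfl, if_pos rfl]
      rcases par_cases i with ⟨-, h1, h2⟩ | ⟨-, h1, h2⟩ <;>
        rcases par_cases j with ⟨-, h3, h4⟩ | ⟨-, h3, h4⟩
      · rw [h1, h2, h3, h4, add_zero, zero_mul, sgn_zero, one_mul]
      · rw [h.oddSq i j (by rw [h1, h3]), smul_zero, smul_zero]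
      · rw [h.oddSq i j (by rw [h1, h3]), smul_zero, smul_zero]
      · rw [h1, h2, h3, h4, sgn_congr (b := 0) (by decide), sgn_zero, one_mul]
    · rw [if_neg hjl.not_gt, zero_smul, add_zero, rDiag, if_pos rfl, rDiag, if_neg hjl.ne',
        h.row i l j hjl, smul_smul, mul_one, ← mul_assoc, mul_comm (par i + par j), sgn_mul_self,
        one_mul]
  · rw [if_pos hik, rDiag, if_neg hik.ne', one_smul]
    have hk := idxParity_of_lt (lt_four_of_lt hik)
    rcases lt_trichotomy j l with hjl | rfl | hjl
    · rw [if_pos hjl, h.anti k l i j hik hjl, rDiag, if_neg hjl.ne, mul_one, smul_smul,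
        mul_comm (par k + par l), sgn_mul_self, one_smul]
    · rw [if_neg (lt_irrefl _), zero_smul, add_zero, rDiag, if_pos rfl, h.col k i j hik, smul_smul,
        smul_smul, rOff, lam]
      nth_rw 1 [← one_smul Cq (t i j * t k j)]
      rw [← add_smul]
      congr 1
      rcases par_cases i with ⟨-, h1, h2⟩ | ⟨-, h1, h2⟩ <;>
        rcases par_cases j with ⟨-, h3, h4⟩ | ⟨-, h3, h4⟩ <;> simp only [par] at h1 h3 <;>
        simp only [par, h1, h3, h4, hk, mul_zero, add_zero, zero_add, mul_one, sgn_zero,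
          sgn_one, sgn_two, one_mul, Nat.reduceAdd, Nat.reduceMul] <;>
      linear_combination -hq
    · rw [if_neg hjl.not_gt, zero_smul, add_zero, rDiag, if_neg hjl.ne', mul_one,
        h.diag k l i j hik hjl, smul_add, smul_smul, mul_comm (par k + par l), sgn_mul_self,
        one_smul, h.anti k j i l hik hjl, smul_smul, smul_smul]
      congr 2
      have hl := idxParity_of_lt (lt_four_of_lt hjl)
      simp only [rOff, par, hk, hl, zero_add, add_zero, mul_zero, zero_mul, sgn_zero]
      rcases par_cases i with ⟨-, h1, h2⟩ | ⟨-, h1, h2⟩ <;>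
        rcases par_cases j with ⟨-, h3, h4⟩ | ⟨-, h3, h4⟩ <;> simp only [par] at h1 h3 <;>
        simp [h1, h3, sgn_zero, sgn_one, sgn_two]

/-- For an odd entry the R-matrix identity only says that `q + q⁻¹` annihilates the square, so the
vanishing of odd squares is a separate hypothesis. -/
theorem IsRTT.isManin {t : Fin 5 → Fin 5 → A} (h : IsRTT t)
    (h0 : ∀ i j, par i + par j = 1 → t i j * t i j = 0) : IsManin t where
  row i j l hjl := by
    have h1 := h i i j l
    rw [if_neg (lt_irrefl _), zero_smul, add_zero, if_pos hjl, rDiag, if_pos rfl, rDiag,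
      if_neg hjl.ne, mul_one, ← sub_eq_iff_eq_add, ← sub_smul] at h1
    have hj := idxParity_of_lt (lt_four_of_lt hjl)
    -- The R-matrix identity leaves the coefficient `qIdx 4 1 i - rOff i j i` on the left; by the
    -- quadratic relation its inverse is `qIdx 4 1 i`.
    have h2 : qIdx 4 1 i * (qIdx 4 1 i - rOff i j i) = 1 := by
      rw [rOff, lam]
      rcases par_cases i with ⟨-, h1, h2⟩ | ⟨-, h1, h2⟩ <;> simp only [par] at h1 <;>
        simp only [par, h1, h2, hj, mul_zero, zero_mul, add_zero, zero_add, mul_one, sgn_zero,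
          sgn_one] <;>
        linear_combination qpow_one_mul_neg_one
    rw [mul_comm (sgn _), ← smul_smul, ← h1, smul_smul, h2, one_smul]
  col i k j hik := by
    have h1 := h i k j j
    rwa [if_neg hik.not_gt, zero_smul, add_zero, if_neg (lt_irrefl _), zero_smul, add_zero, rDiag,
      if_neg hik.ne, one_smul, rDiag, if_pos rfl] at h1
  anti i j k l hik hlj := by
    have h1 := h i k j l
    rwa [if_neg hik.not_gt, zero_smul, add_zero, if_neg hlj.not_gt, zero_smul, add_zero, rDiag,
      if_neg hik.ne, one_smul, rDiag, if_neg hlj.ne', mul_one] at h1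
  diag i j k l hik hjl := by
    have h1 := h i k j l
    rwa [if_neg hik.not_gt, zero_smul, add_zero, if_pos hjl, rDiag,
      if_neg hik.ne, one_smul, rDiag, if_neg hjl.ne, mul_one, rOff_of_lt hjl] at h1
  oddSq := h0

/-- A matrix satisfying Manin's relations defines a homomorphism from the algebra of quantum
matrices. -/
theorem IsManin.lift_rel {t : Fin 5 → Fin 5 → A} (h : IsManin t)
    {x y : FreeAlgebra Cq (Fin (4 + 1) × Fin (4 + 1))} (hxy : MqRel 4 1 x y) :
    FreeAlgebra.lift Cq (fun z : Fin (4 + 1) × Fin (4 + 1) => t z.1 z.2) x =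
      FreeAlgebra.lift Cq (fun z : Fin (4 + 1) × Fin (4 + 1) => t z.1 z.2) y := by
  induction hxy with
  | row i j l hjl =>
    simp only [fa, map_mul, map_smul, FreeAlgebra.lift_ι_apply]
    exact h.row i j l hjl
  | col i k j hik =>
    simp only [fa, map_mul, map_smul, FreeAlgebra.lift_ι_apply]
    exact h.col i k j hik
  | anti i j k l hlt =>
    simp only [fa, map_mul, map_smul, FreeAlgebra.lift_ι_apply]
    rcases hlt with ⟨hik, hlj⟩ | ⟨hki, hjl⟩
    · exact h.anti i j k l hik hlj
    · rw [h.anti k l i j hki hjl, smul_smul, entrySign, entryParity, entryParity,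
        mul_comm (par k + par l), ← sgn, sgn_mul_self, one_smul]
  | diag i j k l hik hjl =>
    simp only [fa, map_mul, map_sub, map_smul, FreeAlgebra.lift_ι_apply]
    rw [sub_eq_iff_eq_add', mul_comm (entrySign _ _ _ _ _ _)]
    exact h.diag i j k l hik hjl
  | oddSq i j hij =>
    simp only [fa, map_mul, map_zero, FreeAlgebra.lift_ι_apply]
    exact h.oddSq i j hij

end Manin

end QuantumGr

namespace QuantumGr

/-! ### Weighted shift operators -/

/-- The free module on integral exponent vectors. -/
abbrev ShiftSpace : Type := (ℕ → ℤ) →₀ Cq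

/-- The weighted shift `e_n ↦ w(n) e_{n + v}`. -/
noncomputable def shiftOp (w : (ℕ → ℤ) → Cq) (v : ℕ → ℤ) : Module.End Cq ShiftSpace :=
  Finsupp.linearCombination Cq fun n => Finsupp.single (n + v) (w n)

theorem shiftOp_single (w : (ℕ → ℤ) → Cq) (v n : ℕ → ℤ) (a : Cq) :
    shiftOp w v (Finsupp.single n a) = Finsupp.single (n + v) (a * w n) := by
  simp [shiftOp]

theorem shiftOp_mul (w w' : (ℕ → ℤ) → Cq) (v v' : ℕ → ℤ) :
    shiftOp w v * shiftOp w' v' = shiftOp (fun n => w (n + v') * w' n) (v + v') := by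
  refine Finsupp.lhom_ext fun n a => ?_
  rw [Module.End.mul_apply, shiftOp_single, shiftOp_single, shiftOp_single, add_assoc,
    add_comm v' v, mul_assoc, mul_comm (w' n)]

theorem shiftOp_smul (c : Cq) (w : (ℕ → ℤ) → Cq) (v : ℕ → ℤ) :
    c • shiftOp w v = shiftOp (fun n => c * w n) v := by
  refine Finsupp.lhom_ext fun n a => ?_
  rw [LinearMap.smul_apply, shiftOp_single, shiftOp_single, Finsupp.smul_single, smul_eq_mul,
    mul_left_comm]

theorem shiftOp_add (w w' : (ℕ → ℤ) → Cq) (v : ℕ → ℤ) :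
    shiftOp w v + shiftOp w' v = shiftOp (fun n => w n + w' n) v := by
  refine Finsupp.lhom_ext fun n a => ?_
  rw [LinearMap.add_apply, shiftOp_single, shiftOp_single, shiftOp_single, mul_add,
    Finsupp.single_add]

theorem shiftOp_congr {w w' : (ℕ → ℤ) → Cq} {v v' : ℕ → ℤ} (hw : ∀ n, w n = w' n) (hv : v = v') :
    shiftOp w v = shiftOp w' v' := by
  rw [funext hw, hv]

theorem shiftOp_eq_zero {w : (ℕ → ℤ) → Cq} {v : ℕ → ℤ} (hw : ∀ n, w n = 0) : shiftOp w v = 0 := by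
  refine Finsupp.lhom_ext fun n a => ?_
  rw [shiftOp_single, hw, mul_zero, Finsupp.single_zero, LinearMap.zero_apply]

theorem shiftOp_mul_comm {w w' : (ℕ → ℤ) → Cq} {v v' : ℕ → ℤ} {c : Cq}
    (h : ∀ n, w (n + v') * w' n = c * (w' (n + v) * w n)) :
    shiftOp w v * shiftOp w' v' = c • (shiftOp w' v' * shiftOp w v) := by
  rw [shiftOp_mul, shiftOp_mul, shiftOp_smul]
  exact shiftOp_congr h (add_comm _ _)

theorem shiftOp_one_zero : shiftOp (fun _ => 1) 0 = 1 := by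
  refine Finsupp.lhom_ext fun n a => ?_
  rw [shiftOp_single, mul_one, add_zero, Module.End.one_apply]

theorem isUnit_shiftOp {w : (ℕ → ℤ) → Cq} (v : ℕ → ℤ) (h : ∀ n, IsUnit (w n)) :
    IsUnit (shiftOp w v) := by
  choose u hu using h
  rw [isUnit_iff_exists]
  refine ⟨shiftOp (fun n => ↑(u (n - v))⁻¹) (-v), ?_, ?_⟩
  · rw [shiftOp_mul, ← shiftOp_one_zero]
    refine shiftOp_congr (fun n => ?_) (add_neg_cancel v)
    rw [← hu, ← sub_eq_add_neg, Units.mul_inv]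
  · rw [shiftOp_mul, ← shiftOp_one_zero]
    refine shiftOp_congr (fun n => ?_) (neg_add_cancel v)
    rw [← hu, add_sub_cancel_right, Units.inv_mul]

theorem isUnit_qpow (k : ℤ) : IsUnit (qpow k) :=
  IsUnit.of_mul_eq_one (qpow (-k)) (by rw [qpow_mul, add_neg_cancel, qpow_zero])

/-! ### A triangular quantum supermatrix of weighted shifts -/

section Triangular

variable (o : ℕ) (σ : (ℕ → ℤ) → Cq) (θ : Cq) (s : ℕ → ℤ)

/-- The shift vector of the entry `(i, j)`. -/
def stepVec (i j : Fin 5) (c : ℕ) : ℤ := (if o + j < c ∧ c ≤ o + i then 1 else 0) + s c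

/-- The part of the weight of the entry `(i, j)` which is not a power of `q`. -/
noncomputable def baseWeight (i j : Fin 5) (n : ℕ → ℤ) : Cq :=
  (if j = 0 ∧ i ≠ 0 then θ else 1) * if i = 4 ∧ j ≠ 4 then (if n (o + 4) = 0 then σ n else 0) else 1

/-- The exponent of `q` in the weight of the entry `(i, j)`. -/
def weightExp (i j : Fin 5) (n : ℕ → ℤ) : ℤ :=
  (if j = 4 then -n (o + j) else n (o + j)) - n (o + i + 1)

/-- The entries of a lower triangular quantum supermatrix of weighted shifts in the coordinates
`o, …, o + 5`. -/
noncomputable def triMatrix (i j : Fin 5) : Module.End Cq ShiftSpace :=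
  if j ≤ i then
    shiftOp (fun n => baseWeight o σ θ i j n * qpow (weightExp o i j n)) (stepVec o s i j)
  else 0

variable {o σ θ s}

theorem triMatrix_of_le {i j : Fin 5} (h : j ≤ i) : triMatrix o σ θ s i j =
    shiftOp (fun n => baseWeight o σ θ i j n * qpow (weightExp o i j n)) (stepVec o s i j) :=
  if_pos h

theorem triMatrix_of_lt {i j : Fin 5} (h : i < j) : triMatrix o σ θ s i j = 0 :=
  if_neg h.not_ge

theorem add_stepVec_apply (hs : ∀ c ≤ 5, s (o + c) = 0) (k l : Fin 5) (n : ℕ → ℤ) {c : ℕ}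
    (hc : c ≤ 5) :
    (n + stepVec o s k l) (o + c) = n (o + c) + if (l : ℕ) < c ∧ c ≤ k then 1 else 0 := by
  simp [stepVec, hs c hc]

/-- The truncation reads the coordinate `o + 4`, which only the odd entries `(4, l)`, `l ≠ 4`,
shift; hence the exclusion of two odd entries. -/
theorem baseWeight_add_stepVec (hs : ∀ c ≤ 5, s (o + c) = 0)
    (hσ : ∀ n k l, σ (n + stepVec o s k l) = σ n) {i j k l : Fin 5} (n : ℕ → ℤ)
    (h : ¬ (i = 4 ∧ j ≠ 4 ∧ k = 4 ∧ l ≠ 4)) :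
    baseWeight o σ θ i j (n + stepVec o s k l) = baseWeight o σ θ i j n := by
  rw [baseWeight, baseWeight, hσ, add_stepVec_apply hs _ _ _ (by omega)]
  by_cases h1 : i = 4 ∧ j ≠ 4
  · rw [if_neg (show ¬ ((l : ℕ) < 4 ∧ 4 ≤ (k : ℕ)) by omega), add_zero]
  · rw [if_neg h1, if_neg h1]

theorem weightExp_add_stepVec (hs : ∀ c ≤ 5, s (o + c) = 0) (i j k l : Fin 5) (n : ℕ → ℤ) :
    weightExp o i j (n + stepVec o s k l) = weightExp o i j n +
      ((if l < j ∧ j ≤ k then (if j = 4 then -1 else 1) else 0) -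
        if l ≤ i ∧ i < k then 1 else 0) := by
  rw [weightExp, weightExp, add_assoc o, add_stepVec_apply hs _ _ _ (by omega),
    add_stepVec_apply hs _ _ _ (by omega)]
  split_ifs <;> omega

/-- An odd entry acts only where the coordinate `o + 4` is zero and raises it to one, so a second
odd entry annihilates the result. -/
theorem triMatrix_mul_odd (hs : ∀ c ≤ 5, s (o + c) = 0) {j l : Fin 5} (hj : j ≠ 4) (hl : l ≠ 4) :
    triMatrix o σ θ s 4 j * triMatrix o σ θ s 4 l = 0 := by
  rw [triMatrix_of_le (by omega), triMatrix_of_le (by omega), shiftOp_mul]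
  refine shiftOp_eq_zero fun n => ?_
  by_cases hn : n (o + 4) = 0
  · have h1 : baseWeight o σ θ 4 j (n + stepVec o s 4 l) = 0 := by
      have h2 : (n + stepVec o s 4 l) (o + 4) ≠ 0 := by
        rw [add_stepVec_apply hs _ _ _ (by omega), hn, if_pos (by omega)]
        decide
      rw [baseWeight, if_pos (⟨rfl, hj⟩ : (4 : Fin 5) = 4 ∧ j ≠ 4), if_neg h2, mul_zero]
    rw [h1, zero_mul, zero_mul]
  · have h1 : baseWeight o σ θ 4 l n = 0 := by
      rw [baseWeight, if_pos (⟨rfl, hl⟩ : (4 : Fin 5) = 4 ∧ l ≠ 4), if_neg hn, mul_zero]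
    rw [h1, zero_mul, mul_zero]

/-- The exponent of `q` is additive in the exponent vector, so the two orders differ by a constant
power of `q`: the change of one weight under the shift of the other, minus the reverse. The
hypothesis `he` records that difference. -/
theorem triMatrix_mul_comm (hs : ∀ c ≤ 5, s (o + c) = 0)
    (hσ : ∀ n k l, σ (n + stepVec o s k l) = σ n) {i j k l : Fin 5} (hji : j ≤ i) (hlk : l ≤ k)
    (h : ¬ (i = 4 ∧ j ≠ 4 ∧ k = 4 ∧ l ≠ 4)) (e : ℤ)
    (he : (if l < j ∧ j ≤ k then (if j = 4 then -1 else 1) else 0) -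
        (if l ≤ i ∧ i < k then 1 else 0) =
      e + ((if j < l ∧ l ≤ i then (if l = 4 then -1 else 1) else 0) -
        if j ≤ k ∧ k < i then 1 else 0)) :
    triMatrix o σ θ s i j * triMatrix o σ θ s k l =
      qpow e • (triMatrix o σ θ s k l * triMatrix o σ θ s i j) := by
  rw [triMatrix_of_le hji, triMatrix_of_le hlk]
  refine shiftOp_mul_comm fun n => ?_
  rw [baseWeight_add_stepVec hs hσ n h, baseWeight_add_stepVec hs hσ n (by tauto),
    weightExp_add_stepVec hs, weightExp_add_stepVec hs, he, mul_mul_mul_comm, qpow_mul,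
    mul_mul_mul_comm, qpow_mul, mul_left_comm, qpow_mul, mul_comm (baseWeight o σ θ i j n)]
  congr 2
  ring

theorem triMatrix_diag (hs : ∀ c ≤ 5, s (o + c) = 0)
    (hσ : ∀ n k l, σ (n + stepVec o s k l) = σ n) {i j k l : Fin 5} (hik : i < k) (hjl : j < l)
    (hli : l ≤ i) :
    triMatrix o σ θ s i j * triMatrix o σ θ s k l =
      triMatrix o σ θ s k l * triMatrix o σ θ s i j +
        lam • (triMatrix o σ θ s k j * triMatrix o σ θ s i l) := by
  rw [triMatrix_of_le (show j ≤ i by omega), triMatrix_of_le (show l ≤ k by omega),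
    triMatrix_of_le (show j ≤ k by omega), triMatrix_of_le hli, shiftOp_mul, shiftOp_mul,
    shiftOp_mul, shiftOp_smul]
  have hv : stepVec o s k l + stepVec o s i j = stepVec o s i j + stepVec o s k l := add_comm _ _
  have hv' : stepVec o s k j + stepVec o s i l = stepVec o s i j + stepVec o s k l := by
    funext c
    simp only [stepVec, Pi.add_apply]
    split_ifs <;> omega
  rw [hv, hv', shiftOp_add]
  refine shiftOp_congr (fun n => ?_) rfl
  -- All three products perform the same shift. Relative to the third one the first two carry `q⁻¹`
  -- and `q`, so the claim is `q⁻¹ = q + (q⁻¹ - q)`.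
  have e1 : weightExp o i j (n + stepVec o s k l) + weightExp o k l n =
      weightExp o k j n + weightExp o i l n + -1 := by
    rw [weightExp_add_stepVec hs]
    simp only [weightExp]
    split_ifs <;> omega
  have e2 : weightExp o k l (n + stepVec o s i j) + weightExp o i j n =
      weightExp o k j n + weightExp o i l n + 1 := by
    rw [weightExp_add_stepVec hs]
    simp only [weightExp]
    split_ifs <;> omega
  have e3 : weightExp o k j (n + stepVec o s i l) + weightExp o i l n =
      weightExp o k j n + weightExp o i l n := by
    rw [weightExp_add_stepVec hs]
    split_ifs <;> omega
  have hb : baseWeight o σ θ k j n * baseWeight o σ θ i l n =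
      baseWeight o σ θ i j n * baseWeight o σ θ k l n := by
    simp only [baseWeight]
    rw [if_neg (show ¬ (i = 4 ∧ l ≠ 4) by omega), if_neg (show ¬ (i = 4 ∧ j ≠ 4) by omega),
      if_neg (show ¬ (l = 0 ∧ i ≠ 0) by omega), if_neg (show ¬ (l = 0 ∧ k ≠ 0) by omega),
      if_congr (show (j = 0 ∧ k ≠ 0) ↔ (j = 0 ∧ i ≠ 0) by omega) rfl rfl,
      if_congr (show (k = 4 ∧ j ≠ 4) ↔ (k = 4 ∧ l ≠ 4) by omega) rfl rfl]
    ring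
  rw [baseWeight_add_stepVec hs hσ n (by omega), baseWeight_add_stepVec hs hσ n (by omega),
    baseWeight_add_stepVec hs hσ n (by omega), mul_mul_mul_comm, qpow_mul, e1, mul_mul_mul_comm,
    qpow_mul, e2, mul_mul_mul_comm, qpow_mul, e3, hb, mul_comm (baseWeight o σ θ k l n), lam,
    ← qpow_mul _ (-1), ← qpow_mul _ 1]
  ring

theorem triMatrix_isManin (hs : ∀ c ≤ 5, s (o + c) = 0)
    (hσ : ∀ n k l, σ (n + stepVec o s k l) = σ n) : IsManin (triMatrix o σ θ s) where
  row i j l hjl := by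
    have hj : par j = 0 := idxParity_of_lt (lt_four_of_lt hjl)
    rcases lt_or_ge i l with hil | hli
    · rw [triMatrix_of_lt hil, mul_zero, zero_mul, smul_zero]
    by_cases hodd : i = 4 ∧ l ≠ 4
    · obtain ⟨rfl, hl⟩ := hodd
      rw [triMatrix_mul_odd hs (by omega) hl, triMatrix_mul_odd hs hl (by omega), smul_zero]
    -- Triangularity forces `i = 4` when `l = 4`, so the sign of the exponent is decided by the
    -- parity of the row.
    rw [triMatrix_mul_comm hs hσ (e := if l = 4 then 1 else -1) (by omega) hli (by omega)
      (by split_ifs <;> omega)]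
    congr 1
    rcases par_cases i with ⟨hi, h1, h2⟩ | ⟨rfl, h1, h2⟩
    · rw [h1, h2, hj, add_zero, zero_mul, sgn_zero, one_mul, if_neg (by omega)]
    · obtain rfl : l = 4 := by omega
      rw [h1, h2, hj, if_pos rfl, add_zero, one_mul, one_add_one_eq_two, sgn_two, one_mul]
  col i k j hik := by
    rcases lt_or_ge i j with hij | hji
    · rw [triMatrix_of_lt hij, mul_zero, zero_mul, smul_zero]
    have hi : par i = 0 := idxParity_of_lt (lt_four_of_lt hik)
    have hj : par j = 0 := idxParity_of_lt (by omega)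
    rw [triMatrix_mul_comm hs hσ (e := -1) hji (by omega) (by omega) (by split_ifs <;> omega), hi,
      hj, qIdx_of_lt (by omega), add_zero, zero_mul, sgn_zero, one_mul]
  anti i j k l hik hlj := by
    rcases lt_or_ge i j with hij | hji
    · rw [triMatrix_of_lt hij, mul_zero, zero_mul, smul_zero]
    have hi : par i = 0 := idxParity_of_lt (lt_four_of_lt hik)
    have hj : par j = 0 := idxParity_of_lt (by omega)
    rw [triMatrix_mul_comm hs hσ (e := 0) hji (by omega) (by omega) (by split_ifs <;> omega), hi,
      hj, add_zero, zero_mul, sgn_zero, qpow_zero]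
  diag i j k l hik hjl := by
    have hi : par i = 0 := idxParity_of_lt (lt_four_of_lt hik)
    have hj : par j = 0 := idxParity_of_lt (lt_four_of_lt hjl)
    rw [hi, hj, add_zero, zero_mul, zero_mul, sgn_zero, one_smul, mul_one]
    rcases lt_or_ge i l with hil | hli
    · rw [triMatrix_of_lt hil, mul_zero, smul_zero, add_zero]
      rcases lt_or_ge i j with hij | hji
      · rw [triMatrix_of_lt hij, mul_zero, zero_mul]
      rcases lt_or_ge k l with hkl | hlk
      · rw [triMatrix_of_lt hkl, mul_zero, zero_mul]
      rw [triMatrix_mul_comm hs hσ (e := 0) hji hlk (by omega) (by split_ifs <;> omega), qpow_zero,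
        one_smul]
    · exact triMatrix_diag hs hσ hik hjl hli
  oddSq i j hij := by
    rcases lt_or_ge i j with hlt | hji
    · rw [triMatrix_of_lt hlt, mul_zero]
    rcases par_cases i with ⟨hi, h1, -⟩ | ⟨rfl, h1, -⟩
    · rw [h1, show par j = 0 from idxParity_of_lt (by omega)] at hij
      omega
    · exact triMatrix_mul_odd hs (by rintro rfl; simp [par, idxParity_four] at hij)
        (by rintro rfl; simp [par, idxParity_four] at hij)

end Triangular

end QuantumGr

namespace QuantumGr

/-! ### A representation of the quantum general linear supergroup -/

/-- The parity of the coordinate `4`, as a sign. -/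
noncomputable def oddSign (n : ℕ → ℤ) : Cq := if Even (n 4) then 1 else -1

/-- The first triangular factor. -/
noncomputable def triLeft (i j : Fin 5) : Module.End Cq ShiftSpace :=
  triMatrix 0 (fun _ => 1) 1 0 i j

/-- The second triangular factor; its first column is diagonal, and it shifts the coordinate `12`,
which counts the degree. -/
noncomputable def triRight (i j : Fin 5) : Module.End Cq ShiftSpace :=
  triMatrix 6 oddSign 0 (Pi.single 12 1) i j

theorem single_twelve_apply {c : ℕ} (hc : c ≤ 5) : (Pi.single 12 1 : ℕ → ℤ) (6 + c) = 0 := by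
  rw [Pi.single_apply, if_neg (by omega)]

theorem stepVec_right_apply_of_le (i j : Fin 5) {c : ℕ} (hc : c ≤ 5) :
    stepVec 6 (Pi.single 12 1) i j c = 0 := by
  rw [stepVec, if_neg (by omega), Pi.single_apply, if_neg (by omega), add_zero]

theorem stepVec_left_apply_of_ge (i j : Fin 5) {c : ℕ} (hc : 5 ≤ c) :
    stepVec 0 0 i j c = 0 := by
  rw [stepVec, if_neg (by omega), Pi.zero_apply, add_zero]

theorem triLeft_isManin : IsManin triLeft :=
  triMatrix_isManin (fun _ _ => rfl) fun _ _ _ => rfl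

theorem oddSign_add_of_eq_zero {n v : ℕ → ℤ} (h : v 4 = 0) : oddSign (n + v) = oddSign n := by
  rw [oddSign, oddSign, Pi.add_apply, h, add_zero]

theorem triRight_isManin : IsManin triRight :=
  triMatrix_isManin (fun _ hc => single_twelve_apply hc) fun _ _ _ =>
    oddSign_add_of_eq_zero (stepVec_right_apply_of_le _ _ (by norm_num))

theorem weightExp_left_add (k b : Fin 5) {n v : ℕ → ℤ} (hv : ∀ c ≤ 5, v c = 0) :
    weightExp 0 k b (n + v) = weightExp 0 k b n := by
  simp only [weightExp, Pi.add_apply]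
  rw [hv _ (by omega), hv _ (by omega), add_zero, add_zero]

theorem weightExp_right_add (k b : Fin 5) {n v : ℕ → ℤ} (hv : ∀ c, 5 ≤ c → v c = 0) :
    weightExp 6 k b (n + v) = weightExp 6 k b n := by
  simp only [weightExp, Pi.add_apply]
  rw [hv _ (by omega), hv _ (by omega), add_zero, add_zero]

theorem baseWeight_left_add (k b : Fin 5) {n v : ℕ → ℤ} (hv : ∀ c ≤ 5, v c = 0) :
    baseWeight 0 (fun _ => 1) 1 k b (n + v) = baseWeight 0 (fun _ => 1) 1 k b n := by
  simp only [baseWeight, Pi.add_apply]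
  rw [hv _ (by omega), add_zero]

theorem sgn_par_add_mul {k b : Fin 5} (hbk : b ≤ k) (m : ℕ) :
    sgn ((par k + par b) * m) = if k = 4 ∧ b ≠ 4 then sgn m else 1 := by
  rcases par_cases k with ⟨hk, h1, -⟩ | ⟨rfl, h1, -⟩
  · rw [h1, show par b = 0 from idxParity_of_lt (by omega), if_neg (by omega), add_zero, zero_mul,
      sgn_zero]
  rcases par_cases b with ⟨hb, h2, -⟩ | ⟨rfl, h2, -⟩
  · rw [h1, h2, if_pos ⟨rfl, hb.ne⟩, add_zero, one_mul]
  · rw [if_neg (fun h => h.2 rfl), sgn_congr (b := 0) (by simp [idxParity_four]), sgn_zero]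

/-- An odd entry of the left factor changes the coordinate `4` by one and so flips `oddSign`, which
only the odd entries of the right factor carry. This produces the supersign between the two factors,
whose coordinates are otherwise disjoint. -/
theorem baseWeight_right_add (a j : Fin 5) {k b : Fin 5} (hja : j ≤ a) (hbk : b ≤ k) (n : ℕ → ℤ) :
    baseWeight 6 oddSign 0 a j (n + stepVec 0 0 k b) =
      sgn ((par a + par j) * (par k + par b)) * baseWeight 6 oddSign 0 a j n := by
  have h10 : stepVec 0 0 k b (6 + 4) = 0 := stepVec_left_apply_of_ge _ _ (by norm_num)
  have h4 : stepVec 0 0 k b 4 = if k = 4 ∧ b ≠ 4 then 1 else 0 := by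
    rw [stepVec, Pi.zero_apply, add_zero]
    exact if_congr (by omega) rfl rfl
  have hk := sgn_par_add_mul hbk 1
  rw [mul_one, sgn_one] at hk
  rw [sgn_par_add_mul hja, hk, baseWeight, baseWeight, Pi.add_apply, h10, add_zero]
  by_cases ha : a = 4 ∧ j ≠ 4
  · have hσ : oddSign (n + stepVec 0 0 k b) =
        (if k = 4 ∧ b ≠ 4 then -1 else 1) * oddSign n := by
      rw [oddSign, oddSign, Pi.add_apply, h4]
      by_cases hkb : k = 4 ∧ b ≠ 4
      · by_cases hn : Even (n 4) <;> simp [hkb, hn]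
      · rw [if_neg hkb, if_neg hkb, add_zero, one_mul]
    rw [if_pos ha, if_pos ha, if_pos ha, hσ]
    split_ifs <;> ring
  · rw [if_neg ha, if_neg ha, if_neg ha, one_mul]

theorem superCommute_triLeft_triRight : SuperCommute triLeft triRight := by
  intro a j k b
  rcases lt_or_ge a j with haj | hja
  · rw [triRight, triMatrix_of_lt haj, mul_zero, zero_mul, smul_zero]
  rcases lt_or_ge k b with hkb | hbk
  · rw [triLeft, triMatrix_of_lt hkb, mul_zero, zero_mul, smul_zero]
  rw [triRight, triLeft, triMatrix_of_le hja, triMatrix_of_le hbk]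
  refine shiftOp_mul_comm fun n => ?_
  rw [baseWeight_right_add a j hja hbk,
    weightExp_right_add a j fun c hc => stepVec_left_apply_of_ge k b hc,
    baseWeight_left_add k b fun c hc => stepVec_right_apply_of_le a j hc,
    weightExp_left_add k b fun c hc => stepVec_right_apply_of_le a j hc]
  ring

/-- The matrix of operators representing the generators of `GL_q(4|1)`. -/
noncomputable def repMatrix : Fin 5 → Fin 5 → Module.End Cq ShiftSpace := matMul triLeft triRight

/-- The evaluation at `q = 1`. -/
noncomputable def evalOne : Cq →+* ℂ := LaurentPolynomial.eval₂ (RingHom.id ℂ) 1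

theorem evalOne_qpow (k : ℤ) : evalOne (qpow k) = 1 := by
  rw [evalOne, qpow, LaurentPolynomial.eval₂_T, one_zpow, Units.val_one]

theorem IsRTT.smul_odd_sq {A : Type*} [Ring A] [Algebra Cq A] {t : Fin 5 → Fin 5 → A}
    (h : IsRTT t) {i j : Fin 5} (hij : par i + par j = 1) :
    (qIdx 4 1 i + qIdx 4 1 j) • (t i j * t i j) = 0 := by
  have h1 := h i i j j
  rwa [if_neg (lt_irrefl _), zero_smul, add_zero, if_neg (lt_irrefl _), zero_smul, add_zero, rDiag,
    rDiag, if_pos rfl, if_pos rfl, hij, mul_one, sgn_one, neg_one_mul, neg_smul,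
    eq_neg_iff_add_eq_zero, ← add_smul] at h1

theorem repMatrix_isManin : IsManin repMatrix := by
  have h : IsRTT repMatrix := triLeft_isManin.isRTT.matMul triRight_isManin.isRTT
    superCommute_triLeft_triRight
  -- The operators are torsion-free over the domain `Cq`, and the coefficient annihilating the odd
  -- square is nonzero because it takes the value 2 at `q = 1`.
  refine h.isManin fun i j hij => (smul_eq_zero.1 (h.smul_odd_sq hij)).resolve_left fun h0 => ?_
  have h2 := congrArg evalOne h0
  rw [map_add, qIdx, qIdx, evalOne_qpow, evalOne_qpow, map_zero] at h2
  norm_num at h2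

theorem repMatrix_of_lt {i j : Fin 5} (h : i < j) : repMatrix i j = 0 := by
  rw [repMatrix, matMul]
  refine Finset.sum_eq_zero fun a _ => ?_
  rcases lt_or_ge i a with hia | hai
  · rw [triLeft, triMatrix_of_lt hia, zero_mul]
  · rw [triRight, triMatrix_of_lt (lt_of_le_of_lt hai h), mul_zero]

theorem repMatrix_diag (i : Fin 5) : repMatrix i i = triLeft i i * triRight i i := by
  rw [repMatrix, matMul]
  refine Finset.sum_eq_single i (fun a _ ha => ?_) (by simp)
  rcases lt_or_gt_of_ne ha with hai | hia
  · rw [triRight, triMatrix_of_lt hai, mul_zero]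
  · rw [triLeft, triMatrix_of_lt hia, zero_mul]

theorem baseWeight_diag (o : ℕ) (σ : (ℕ → ℤ) → Cq) (θ : Cq) (i : Fin 5) (n : ℕ → ℤ) :
    baseWeight o σ θ i i n = 1 := by
  simp [baseWeight]

theorem isUnit_triMatrix_diag (o : ℕ) (σ : (ℕ → ℤ) → Cq) (θ : Cq) (s : ℕ → ℤ) (i : Fin 5) :
    IsUnit (triMatrix o σ θ s i i) := by
  rw [triMatrix_of_le le_rfl]
  refine isUnit_shiftOp _ fun n => ?_
  rw [baseWeight_diag, one_mul]
  exact isUnit_qpow _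

theorem isUnit_repMatrix_diag (i : Fin 5) : IsUnit (repMatrix i i) := by
  rw [repMatrix_diag]
  exact (isUnit_triMatrix_diag _ _ _ _ _).mul (isUnit_triMatrix_diag _ _ _ _ _)

/-! ### Quantum determinants of lower triangular matrices. -/

theorem perm_eq_one_of_le {r : ℕ} {σ : Equiv.Perm (Fin r)} (h : ∀ i, σ i ≤ i) : σ = 1 := by
  -- Both sides of the termwise inequality have the same sum, so every inequality is an equality.
  have h1 := (Finset.sum_eq_sum_iff_of_le (s := Finset.univ) (f := fun i => ((σ i : Fin r) : ℕ))
    (g := fun i => (i : ℕ)) fun i _ => h i).1 (Equiv.sum_comp σ fun i => (i : ℕ))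
  exact Equiv.ext fun i => Fin.ext (h1 i (Finset.mem_univ i))

theorem qDet_of_lowerTriangular {A : Type*} [Ring A] [Algebra Cq A] {r : ℕ} (e : ℤ)
    {x : Fin r → Fin r → A} (hx : ∀ i j, i < j → x i j = 0) :
    qDet e x = (List.ofFn fun i => x i i).prod := by
  rw [qDet, Finset.sum_eq_single 1]
  · have h0 : permLength (1 : Equiv.Perm (Fin r)) = 0 := by
      rw [permLength, Finset.card_eq_zero, Finset.filter_eq_empty_iff]
      exact fun z _ h => lt_asymm h.1 h.2
    simp only [h0, pow_zero, one_mul, Nat.cast_zero, mul_zero, qpow_zero, one_smul,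
      Equiv.Perm.one_apply]
  · intro σ _ hσ
    have : ∃ i, i < σ i := by
      by_contra! hle
      exact hσ (perm_eq_one_of_le hle)
    obtain ⟨i, hi⟩ := this
    rw [List.prod_eq_zero, smul_zero]
    rw [List.mem_ofFn]
    exact ⟨i, hx _ _ hi⟩
  · simp

theorem isUnit_qDet_of_lowerTriangular {A : Type*} [Ring A] [Algebra Cq A] {r : ℕ} (e : ℤ)
    {x : Fin r → Fin r → A} (hx : ∀ i j, i < j → x i j = 0) (hu : ∀ i, IsUnit (x i i)) :
    IsUnit (qDet e x) := by
  rw [qDet_of_lowerTriangular e hx]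
  refine (IsUnit.submonoid A).list_prod_mem fun y hy => ?_
  obtain ⟨i, rfl⟩ := List.mem_ofFn.1 hy
  exact hu i

theorem map_qDet {A B : Type*} [Ring A] [Algebra Cq A] [Ring B] [Algebra Cq B] (f : A →ₐ[Cq] B)
    {r : ℕ} (e : ℤ) (x : Fin r → Fin r → A) : f (qDet e x) = qDet e fun i j => f (x i j) := by
  simp only [qDet, map_sum, map_smul, map_list_prod, List.map_ofFn, Function.comp_def]

/-- The operators representing the generators of `GL_q(4|1)`. -/
noncomputable def repGen : GLGen 4 1 → Module.End Cq ShiftSpace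
  | GLGen.entry i j => repMatrix i j
  | GLGen.invD1 => Ring.inverse (qDet (-1) fun i j : Fin 4 =>
      repMatrix (Fin.castAdd 1 i) (Fin.castAdd 1 j))
  | GLGen.invD2 => Ring.inverse (qDet 1 fun i j : Fin 1 =>
      repMatrix (Fin.natAdd 4 i) (Fin.natAdd 4 j))

theorem lift_repGen_entryHom (x : FreeAlgebra Cq (Fin (4 + 1) × Fin (4 + 1))) :
    FreeAlgebra.lift Cq repGen (entryHom 4 1 x) =
      FreeAlgebra.lift Cq (fun z : Fin (4 + 1) × Fin (4 + 1) => repMatrix z.1 z.2) x := by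
  rw [← AlgHom.comp_apply]
  congr 1
  ext z
  simp [entryHom, repGen]

theorem lift_repGen_detOne : FreeAlgebra.lift Cq repGen (detOne 4 1) =
    qDet (-1) fun i j : Fin 4 => repMatrix (Fin.castAdd 1 i) (Fin.castAdd 1 j) := by
  rw [detOne]
  refine (map_qDet (FreeAlgebra.lift Cq repGen) _ _).trans ?_
  simp only [FreeAlgebra.lift_ι_apply, repGen]

theorem lift_repGen_detTwo : FreeAlgebra.lift Cq repGen (detTwo 4 1) =
    qDet 1 fun i j : Fin 1 => repMatrix (Fin.natAdd 4 i) (Fin.natAdd 4 j) := by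
  rw [detTwo]
  refine (map_qDet (FreeAlgebra.lift Cq repGen) _ _).trans ?_
  simp only [FreeAlgebra.lift_ι_apply, repGen]

theorem lift_repGen_rel {x y : FreeAlgebra Cq (GLGen 4 1)} (h : GLqRel 4 1 x y) :
    FreeAlgebra.lift Cq repGen x = FreeAlgebra.lift Cq repGen y := by
  -- `Ring.inverse` is zero on non-units, so invertibility of both block determinants is what makes
  -- `repGen` respect the relations.
  have h1 : IsUnit (qDet (-1) fun i j : Fin 4 =>
      repMatrix (Fin.castAdd 1 i) (Fin.castAdd 1 j)) :=
    isUnit_qDet_of_lowerTriangular _ (fun i j hij => repMatrix_of_lt hij)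
      fun i => isUnit_repMatrix_diag _
  have h2 : IsUnit (qDet 1 fun i j : Fin 1 =>
      repMatrix (Fin.natAdd 4 i) (Fin.natAdd 4 j)) :=
    isUnit_qDet_of_lowerTriangular _ (fun i j hij => absurd hij (by simp))
      fun i => isUnit_repMatrix_diag _
  induction h with
  | mat hxy =>
    rw [lift_repGen_entryHom, lift_repGen_entryHom]
    exact repMatrix_isManin.lift_rel hxy
  | d1_right =>
    rw [map_mul, map_one, lift_repGen_detOne, FreeAlgebra.lift_ι_apply]
    exact Ring.mul_inverse_cancel _ h1
  | d1_left =>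
    rw [map_mul, map_one, lift_repGen_detOne, FreeAlgebra.lift_ι_apply]
    exact Ring.inverse_mul_cancel _ h1
  | d2_right =>
    rw [map_mul, map_one, lift_repGen_detTwo, FreeAlgebra.lift_ι_apply]
    exact Ring.mul_inverse_cancel _ h2
  | d2_left =>
    rw [map_mul, map_one, lift_repGen_detTwo, FreeAlgebra.lift_ι_apply]
    exact Ring.inverse_mul_cancel _ h2

/-- The representation of `GL_q(4|1)` by weighted shift operators. -/
noncomputable def rep : GLq 4 1 →ₐ[Cq] Module.End Cq ShiftSpace :=
  RingQuot.liftAlgHom Cq ⟨FreeAlgebra.lift Cq repGen, fun _ _ h => lift_repGen_rel h⟩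

theorem rep_entry (i j : Fin 5) : rep (entry 4 1 i j) = repMatrix i j := by
  rw [rep, entry, RingQuot.liftAlgHom_mkAlgHom_apply, FreeAlgebra.lift_ι_apply]
  rfl

end QuantumGr

namespace QuantumGr

/-! ### Leading terms -/

/-- The height of an exponent vector: the degree in the shift variables of the second factor. -/
def height (n : ℕ → ℤ) : ℤ := n 7 + n 8 + n 9 + n 10

theorem height_add (n v : ℕ → ℤ) : height (n + v) = height n + height v := by
  simp only [height, Pi.add_apply]
  ring

/-- The span of the basis vectors of height less than `d`. -/
noncomputable def lowerPart (d : ℤ) : Submodule Cq ShiftSpace :=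
  Finsupp.supported Cq Cq {n | height n < d}

theorem single_mem_lowerPart {n : ℕ → ℤ} {d : ℤ} (h : height n < d) (a : Cq) :
    Finsupp.single n a ∈ lowerPart d :=
  Finsupp.single_mem_supported Cq a h

theorem lowerPart_mono {c d : ℤ} (h : c ≤ d) : lowerPart c ≤ lowerPart d :=
  Finsupp.supported_mono fun _ hn => lt_of_lt_of_le hn h

/-- An operator has degree at most `d` if it raises heights by at most `d`. -/
def HasDegLE (f : Module.End Cq ShiftSpace) (d : ℤ) : Prop :=
  ∀ c, ∀ x ∈ lowerPart c, f x ∈ lowerPart (c + d)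

namespace HasDegLE

variable {f g : Module.End Cq ShiftSpace} {d e : ℤ}

theorem mono (h : HasDegLE f d) (hde : d ≤ e) : HasDegLE f e := fun c x hx =>
  lowerPart_mono (by omega) (h c x hx)

theorem zero : HasDegLE 0 d := fun _ _ _ => Submodule.zero_mem _

theorem sub (hf : HasDegLE f d) (hg : HasDegLE g d) : HasDegLE (f - g) d := fun c x hx =>
  Submodule.sub_mem _ (hf c x hx) (hg c x hx)

theorem smul (a : Cq) (hf : HasDegLE f d) : HasDegLE (a • f) d := fun c x hx =>
  Submodule.smul_mem _ a (hf c x hx)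

theorem mul (hf : HasDegLE f d) (hg : HasDegLE g e) : HasDegLE (f * g) (d + e) := fun c x hx => by
  rw [add_comm d e, ← add_assoc]
  exact hf _ _ (hg c x hx)

theorem sum {ι : Type*} {s : Finset ι} {F : ι → Module.End Cq ShiftSpace}
    (h : ∀ i ∈ s, HasDegLE (F i) d) : HasDegLE (∑ i ∈ s, F i) d := fun c x hx => by
  rw [LinearMap.sum_apply]
  exact Submodule.sum_mem _ fun i hi => h i hi c x hx

theorem shiftOp (w : (ℕ → ℤ) → Cq) {v : ℕ → ℤ} (hv : height v ≤ d) :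
    HasDegLE (shiftOp w v) d := fun c x hx => by
  have hle : lowerPart c ≤ (lowerPart (c + d)).comap (QuantumGr.shiftOp w v) := by
    rw [lowerPart, Finsupp.supported_eq_span_single, Submodule.span_le]
    rintro _ ⟨n, hn, rfl⟩
    rw [SetLike.mem_coe, Submodule.mem_comap, shiftOp_single]
    refine single_mem_lowerPart ?_ _
    rw [height_add]
    have : height n < c := hn
    omega
  exact hle hx

end HasDegLE

theorem height_stepVec_left (i j : Fin 5) : height (stepVec 0 0 i j) = 0 := by
  rw [height, stepVec_left_apply_of_ge _ _ (by norm_num),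
    stepVec_left_apply_of_ge _ _ (by norm_num),
    stepVec_left_apply_of_ge _ _ (by norm_num), stepVec_left_apply_of_ge _ _ (by norm_num)]
  rfl

theorem stepVec_right_apply_add (i j : Fin 5) {c : ℕ} (hc : c ≤ 5) :
    stepVec 6 (Pi.single 12 1) i j (6 + c) = if (j : ℕ) < c ∧ c ≤ i then 1 else 0 := by
  rw [stepVec, single_twelve_apply hc, add_zero]
  exact if_congr (by omega) rfl rfl

theorem height_stepVec_right {i j : Fin 5} (h : j ≤ i) :
    height (stepVec 6 (Pi.single 12 1) i j) = (i : ℤ) - j := by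
  have h7 := stepVec_right_apply_add i j (c := 1) (by norm_num)
  have h8 := stepVec_right_apply_add i j (c := 2) (by norm_num)
  have h9 := stepVec_right_apply_add i j (c := 3) (by norm_num)
  have h10 := stepVec_right_apply_add i j (c := 4) (by norm_num)
  rw [height, h7, h8, h9, h10]
  split_ifs <;> omega

theorem hasDegLE_triLeft (i j : Fin 5) : HasDegLE (triLeft i j) 0 := by
  rw [triLeft, triMatrix]
  split_ifs
  · exact HasDegLE.shiftOp _ (height_stepVec_left i j).le
  · exact HasDegLE.zero

theorem hasDegLE_triRight (i j : Fin 5) : HasDegLE (triRight i j) ((i : ℤ) - j) := by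
  rw [triRight, triMatrix]
  split_ifs with h
  · exact HasDegLE.shiftOp _ (height_stepVec_right h).le
  · exact HasDegLE.zero

theorem triRight_zero_right {i : Fin 5} (h : i ≠ 0) : triRight i 0 = 0 := by
  rw [triRight, triMatrix_of_le (Fin.zero_le i)]
  refine shiftOp_eq_zero fun n => ?_
  rw [baseWeight, if_pos ⟨rfl, h⟩, zero_mul, zero_mul]

/-- The choice `θ = 0` in the right factor leaves one term in the first column, so that this column
does not raise the height. -/
theorem repMatrix_zero_right (i : Fin 5) : repMatrix i 0 = triLeft i 0 * triRight 0 0 := by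
  rw [repMatrix, matMul]
  refine Finset.sum_eq_single 0 (fun a _ ha => ?_) (by simp)
  rw [triRight_zero_right ha, mul_zero]

theorem hasDegLE_repMatrix_zero (i : Fin 5) : HasDegLE (repMatrix i 0) 0 := by
  rw [repMatrix_zero_right]
  exact (hasDegLE_triLeft i 0).mul (hasDegLE_triRight 0 0)

theorem hasDegLE_triLeft_mul_triRight {i a : Fin 5} {d : ℤ} (h : (a : ℤ) - 1 ≤ d) :
    HasDegLE (triLeft i a * triRight a 1) d :=
  ((hasDegLE_triLeft i a).mul (hasDegLE_triRight a 1)).mono (by simpa using h)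

theorem triLeft_of_lt {i j : Fin 5} (h : i < j) : triLeft i j = 0 := triMatrix_of_lt h

theorem hasDegLE_repMatrix_one (i : Fin 5) : HasDegLE (repMatrix i 1) ((i : ℤ) - 1) := by
  rw [repMatrix, matMul]
  refine HasDegLE.sum fun a _ => ?_
  rcases lt_or_ge i a with hia | hai
  · rw [triLeft_of_lt hia, zero_mul]
    exact HasDegLE.zero
  · exact hasDegLE_triLeft_mul_triRight (by omega)

/-- The term of the matrix product through `a` has degree `a - 1`, and triangularity allows only `a
≤ j`; the top degree comes from `a = j` alone. -/
theorem hasDegLE_repMatrix_one_sub (j : Fin 5) :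
    HasDegLE (repMatrix j 1 - triLeft j j * triRight j 1) ((j : ℤ) - 2) := by
  have e : repMatrix j 1 - triLeft j j * triRight j 1 =
      ∑ a ∈ Finset.univ.erase j, triLeft j a * triRight a 1 := by
    rw [repMatrix, matMul, ← Finset.sum_erase_add _ _ (Finset.mem_univ j)]
    abel
  rw [e]
  refine HasDegLE.sum fun a ha => ?_
  rcases lt_or_ge j a with hja | haj
  · rw [triLeft_of_lt hja, zero_mul]
    exact HasDegLE.zero
  · have := Finset.ne_of_mem_erase ha
    exact hasDegLE_triLeft_mul_triRight (by omega)

/-- The leading part of the operator representing a quantum super minor. -/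
noncomputable def leadOp (p : PIdx) : Module.End Cq ShiftSpace :=
  triLeft p.fst 0 * triRight 0 0 * (triLeft p.snd p.snd * triRight p.snd 1)

/-- The shift vector of the leading part of a quantum super minor. -/
def leadVec (p : PIdx) : ℕ → ℤ :=
  stepVec 0 0 p.fst 0 + stepVec 6 (Pi.single 12 1) 0 0 +
    (stepVec 0 0 p.snd p.snd + stepVec 6 (Pi.single 12 1) p.snd 1)

theorem PIdx.one_le_snd (p : PIdx) : 1 ≤ p.snd := by
  rcases p with ⟨i, j, hij⟩ | _
  · exact show 1 ≤ j by omega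
  · decide

theorem PIdx.fst_lt_four_of_snd_ne {p : PIdx} (h : p.snd ≠ 4) : p.fst < 4 := by
  rcases p with ⟨i, j, hij⟩ | _
  · exact lt_four_of_lt hij
  · exact absurd rfl h

theorem height_leadVec (p : PIdx) : height (leadVec p) = (p.snd : ℤ) - 1 := by
  rw [leadVec, height_add, height_add, height_add, height_stepVec_left, height_stepVec_left,
    height_stepVec_right le_rfl, height_stepVec_right p.one_le_snd]
  simp

theorem hasDegLE_rep_qMinor_sub (p : PIdx) :
    HasDegLE (rep (qMinor p) - leadOp p) ((p.snd : ℤ) - 2) := by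
  have key : ∀ i j : Fin 5, HasDegLE (repMatrix i 0 * repMatrix j 1 -
      triLeft i 0 * triRight 0 0 * (triLeft j j * triRight j 1)) ((j : ℤ) - 2) := by
    intro i j
    have e : repMatrix i 0 * repMatrix j 1 -
        triLeft i 0 * triRight 0 0 * (triLeft j j * triRight j 1) =
        repMatrix i 0 * (repMatrix j 1 - triLeft j j * triRight j 1) := by
      rw [← repMatrix_zero_right]
      exact (mul_sub (repMatrix i 0) _ _).symm
    rw [e]
    exact ((hasDegLE_repMatrix_zero i).mul (hasDegLE_repMatrix_one_sub j)).mono (by omega)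
  rcases p with ⟨i, j, hij⟩ | _
  · have e : rep (qMinor (PIdx.pair i j hij)) - leadOp (PIdx.pair i j hij) =
        (repMatrix i 0 * repMatrix j 1 -
          triLeft i 0 * triRight 0 0 * (triLeft j j * triRight j 1)) -
        qpow (-1) • (repMatrix i 1 * repMatrix j 0) := by
      have e1 : rep (qMinor (PIdx.pair i j hij)) = repMatrix i 0 * repMatrix j 1 -
          qpow (-1) • (repMatrix i 1 * repMatrix j 0) := by
        refine (map_sub rep _ _).trans ?_
        rw [map_smul, map_mul, map_mul, rep_entry, rep_entry, rep_entry, rep_entry]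
      have e2 : leadOp (PIdx.pair i j hij) =
          triLeft i 0 * triRight 0 0 * (triLeft j j * triRight j 1) := rfl
      rw [e1, e2]
      abel
    rw [e]
    -- The second product of the minor has degree at most `i - 1`, which is below the leading degree
    -- `j - 1` because `i < j`.
    refine (key i j).sub (HasDegLE.smul _ ?_)
    exact ((hasDegLE_repMatrix_one i).mul (hasDegLE_repMatrix_zero j)).mono (by
      show (i : ℤ) - 1 + 0 ≤ (j : ℤ) - 2
      omega)
  · rw [qMinor, map_mul, rep_entry, rep_entry]
    exact key 4 4

theorem triMatrix_diag_single (o : ℕ) (σ : (ℕ → ℤ) → Cq) (θ : Cq) (s : ℕ → ℤ) (i : Fin 5)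
    (n : ℕ → ℤ) {u : Cq} (hu : IsUnit u) :
    ∃ u', IsUnit u' ∧ triMatrix o σ θ s i i (Finsupp.single n u) =
      Finsupp.single (n + stepVec o s i i) u' := by
  rw [triMatrix_of_le le_rfl]
  refine ⟨_, ?_, shiftOp_single _ _ _ _⟩
  rw [baseWeight_diag, one_mul]
  exact hu.mul (isUnit_qpow _)

theorem triRight_single_one {j : Fin 5} (hj : 1 ≤ j) {n : ℕ → ℤ} (hn : j = 4 → n 10 = 0) {u : Cq}
    (hu : IsUnit u) :
    ∃ u', IsUnit u' ∧ triRight j 1 (Finsupp.single n u) =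
      Finsupp.single (n + stepVec 6 (Pi.single 12 1) j 1) u' := by
  rw [triRight, triMatrix_of_le hj]
  refine ⟨_, ?_, shiftOp_single _ _ _ _⟩
  refine hu.mul (IsUnit.mul ?_ (isUnit_qpow _))
  rw [baseWeight, if_neg (by omega), one_mul]
  by_cases h : j = 4
  · rw [if_pos ⟨h, by decide⟩, if_pos (hn h), oddSign]
    split_ifs <;> simp
  · rw [if_neg (fun h' => h h'.1)]
    exact isUnit_one

theorem triLeft_single_zero (i : Fin 5) {n : ℕ → ℤ} (hn : i = 4 → n 4 = 0) {u : Cq}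
    (hu : IsUnit u) :
    ∃ u', IsUnit u' ∧ triLeft i 0 (Finsupp.single n u) =
      Finsupp.single (n + stepVec 0 0 i 0) u' := by
  rw [triLeft, triMatrix_of_le (Fin.zero_le i)]
  refine ⟨_, ?_, shiftOp_single _ _ _ _⟩
  refine hu.mul (IsUnit.mul ?_ (isUnit_qpow _))
  rw [baseWeight, ite_self, one_mul]
  by_cases h : i = 4
  · rw [if_pos ⟨h, by decide⟩, if_pos (by simpa using hn h)]
    exact isUnit_one
  · rw [if_neg (fun h' => h h'.1)]
    exact isUnit_one

/-- All weights are units except for the truncation of odd entries, which occurs only if `p.snd =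
4`; at `n = 0` the truncation is inactive. -/
theorem leadOp_single {p : PIdx} {n : ℕ → ℤ} (hn : p.snd = 4 → n = 0) {u : Cq} (hu : IsUnit u) :
    ∃ u', IsUnit u' ∧ leadOp p (Finsupp.single n u) = Finsupp.single (n + leadVec p) u' := by
  obtain ⟨u₁, hu₁, h₁⟩ := triRight_single_one p.one_le_snd (n := n)
    (fun h => by rw [hn h]; rfl) hu
  obtain ⟨u₂, hu₂, h₂⟩ := triMatrix_diag_single 0 (fun _ => 1) 1 0 p.snd
    (n + stepVec 6 (Pi.single 12 1) p.snd 1) hu₁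
  obtain ⟨u₃, hu₃, h₃⟩ := triMatrix_diag_single 6 oddSign 0 (Pi.single 12 1) 0
    (n + stepVec 6 (Pi.single 12 1) p.snd 1 + stepVec 0 0 p.snd p.snd) hu₂
  obtain ⟨u₄, hu₄, h₄⟩ := triLeft_single_zero p.fst
    (n := n + stepVec 6 (Pi.single 12 1) p.snd 1 + stepVec 0 0 p.snd p.snd +
      stepVec 6 (Pi.single 12 1) 0 0) (by
        intro h
        have h4 : p.snd = 4 := by
          by_contra h'
          exact (PIdx.fst_lt_four_of_snd_ne h').ne h
        rw [hn h4, h4]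
        simp [stepVec]) hu₃
  refine ⟨u₄, hu₄, ?_⟩
  rw [leadOp, Module.End.mul_apply, Module.End.mul_apply, Module.End.mul_apply, h₁]
  rw [show triLeft p.snd p.snd = triMatrix 0 (fun _ => 1) 1 0 p.snd p.snd from rfl, h₂,
    show triRight 0 0 = triMatrix 6 oddSign 0 (Pi.single 12 1) 0 0 from rfl, h₃, h₄]
  congr 1
  rw [leadVec]
  abel

/-- The exponent vector of the leading term of a monomial. -/
def wordVec (w : List PIdx) : ℕ → ℤ := (w.map leadVec).sum

/-- Leading terms multiply along the word. The rightmost factor acts first, so truncation could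
interfere only if a row containing the odd index were followed by another row. -/
theorem rep_word_apply {w : List PIdx} (hw : w.IsChain RowAbove) :
    ∃ u : Cq, IsUnit u ∧ rep (w.map qMinor).prod (Finsupp.single 0 1) -
      Finsupp.single (wordVec w) u ∈ lowerPart (height (wordVec w)) := by
  induction w with
  | nil =>
    refine ⟨1, isUnit_one, ?_⟩
    simp [wordVec]
  | cons p w ih =>
    obtain ⟨u, hu, h⟩ := ih hw.tail
    -- The second column increases weakly and contains the odd index at most once, so a row with
    -- this index in the second column is the last one.
    have hnil : p.snd = 4 → wordVec w = 0 := by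
      intro hp
      rcases w with _ | ⟨r, w⟩
      · rfl
      · exfalso
        have h1 : RowAbove p r := (List.isChain_cons_cons.1 hw).1
        have h2 := h1.2.1
        have h3 := h1.2.2.2
        omega
    obtain ⟨u', hu', h'⟩ := leadOp_single hnil hu
    refine ⟨u', hu', ?_⟩
    set x := rep (w.map qMinor).prod (Finsupp.single 0 1) with hx
    have hv : wordVec (p :: w) = wordVec w + leadVec p := by
      rw [wordVec, List.map_cons, List.sum_cons, add_comm, wordVec]
    -- The error splits into minor minus leading part on the old error, leading part on the old
    -- error, and minor minus leading part on the old leading vector. Each lies below the new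
    -- leading height.
    have e : rep ((p :: w).map qMinor).prod (Finsupp.single 0 1) -
        Finsupp.single (wordVec (p :: w)) u' =
        (rep (qMinor p) - leadOp p) (x - Finsupp.single (wordVec w) u) +
        leadOp p (x - Finsupp.single (wordVec w) u) +
        (rep (qMinor p) - leadOp p) (Finsupp.single (wordVec w) u) := by
      rw [List.map_cons, List.prod_cons, map_mul, Module.End.mul_apply, ← hx, hv, ← h',
        LinearMap.sub_apply, LinearMap.sub_apply, map_sub, map_sub]
      abel
    have hlead : HasDegLE (leadOp p) ((p.snd : ℤ) - 1) := by
      have h1 := ((hasDegLE_triLeft p.fst 0).mul (hasDegLE_triRight 0 0)).mul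
        ((hasDegLE_triLeft p.snd p.snd).mul (hasDegLE_triRight p.snd 1))
      exact h1.mono (by simp)
    have hdiff := hasDegLE_rep_qMinor_sub p
    have h0 : Finsupp.single (wordVec w) u ∈ lowerPart (height (wordVec w) + 1) :=
      single_mem_lowerPart (by omega) u
    rw [e, hv, height_add, height_leadVec]
    refine Submodule.add_mem _ (Submodule.add_mem _ ?_ (hlead _ _ h)) ?_
    · exact lowerPart_mono (by omega) (hdiff _ _ h)
    · exact lowerPart_mono (by omega) (hdiff _ _ h0)

/-! ### Recovering a tableau from its leading exponent -/

/-- The number of entries of a list which are at least `m`. -/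
def countGE (m : ℕ) (l : List (Fin 5)) : ℕ := l.countP fun a : Fin 5 => m ≤ (a : ℕ)

theorem countGE_eq_count_add (l : List (Fin 5)) (a : Fin 5) :
    countGE a l = l.count a + countGE (a + 1) l := by
  induction l with
  | nil => simp [countGE]
  | cons b l ih =>
    simp only [countGE, List.countP_cons, List.count_cons, decide_eq_true_eq, beq_iff_eq] at ih ⊢
    rw [ih]
    split_ifs <;> omega

/-- Differences of consecutive counts are multiplicities, and a sorted list is determined by its
multiplicities. -/
theorem eq_of_countGE_eq {l l' : List (Fin 5)} (hl : l.IsChain (· ≤ ·)) (hl' : l'.IsChain (· ≤ ·))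
    (h : ∀ m, countGE m l = countGE m l') : l = l' := by
  have hp : l.Perm l' := by
    rw [List.perm_iff_count]
    intro a
    have h1 := countGE_eq_count_add l a
    have h2 := countGE_eq_count_add l' a
    have h3 := h a
    have h4 := h (a + 1)
    omega
  exact hp.eq_of_pairwise' (List.isChain_iff_pairwise.1 hl) (List.isChain_iff_pairwise.1 hl')

theorem wordVec_cons (p : PIdx) (w : List PIdx) (c : ℕ) :
    wordVec (p :: w) c = leadVec p c + wordVec w c := by
  rw [wordVec, List.map_cons, List.sum_cons, Pi.add_apply, wordVec]

theorem countGE_fst (w : List PIdx) {m : ℕ} (h1 : 1 ≤ m) (h2 : m ≤ 4) :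
    (countGE m (w.map PIdx.fst) : ℤ) = wordVec w m := by
  induction w with
  | nil => simp [countGE, wordVec]
  | cons p w ih =>
    have hlead : leadVec p m = if m ≤ (p.fst : ℕ) then 1 else 0 := by
      simp only [leadVec, Pi.add_apply]
      rw [stepVec_right_apply_of_le _ _ (by omega), stepVec_right_apply_of_le _ _ (by omega)]
      simp only [stepVec, Pi.zero_apply, add_zero, Fin.coe_ofNat_eq_mod, zero_add]
      rw [if_neg (show ¬ ((p.snd : ℕ) < m ∧ m ≤ (p.snd : ℕ)) by omega), add_zero]
      exact if_congr (by omega) rfl rfl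
    rw [wordVec_cons, ← ih, hlead]
    simp only [countGE, List.map_cons, List.countP_cons, decide_eq_true_eq]
    push_cast
    ring

/-- The shift of the right entry `(j, 1)` starts at coordinate `8`, so `m = 1` is not recorded; it
is not needed, since second entries are never `0`. -/
theorem countGE_snd (w : List PIdx) {m : ℕ} (h1 : 2 ≤ m) (h2 : m ≤ 4) :
    (countGE m (w.map PIdx.snd) : ℤ) = wordVec w (6 + m) := by
  induction w with
  | nil => simp [countGE, wordVec]
  | cons p w ih =>
    have hlead : leadVec p (6 + m) = if m ≤ (p.snd : ℕ) then 1 else 0 := by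
      simp only [leadVec, Pi.add_apply]
      rw [stepVec_left_apply_of_ge _ _ (by omega), stepVec_left_apply_of_ge _ _ (by omega),
        stepVec_right_apply_add _ _ (by omega), stepVec_right_apply_add _ _ (by omega),
        if_neg (fun h => absurd (h.1.trans_le h.2) (lt_irrefl _)), zero_add, zero_add, zero_add]
      refine if_congr ?_ rfl rfl
      have : ((1 : Fin 5) : ℕ) = 1 := rfl
      omega
    rw [wordVec_cons, ← ih, hlead]
    simp only [countGE, List.map_cons, List.countP_cons, decide_eq_true_eq]
    push_cast
    ring

theorem two_mul_length (w : List PIdx) : 2 * (w.length : ℤ) = wordVec w 12 := by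
  induction w with
  | nil => simp [wordVec]
  | cons p w ih =>
    -- Each leading part contains two entries of the right factor, and each of them raises
    -- coordinate `12` by one.
    have hlead : leadVec p 12 = 2 := by
      simp only [leadVec, Pi.add_apply]
      rw [stepVec_left_apply_of_ge _ _ (by omega), stepVec_left_apply_of_ge _ _ (by omega)]
      simp only [stepVec, Pi.single_eq_same]
      rw [if_neg (by omega), if_neg (by omega)]
      norm_num
    rw [wordVec_cons, ← ih, hlead, List.length_cons]
    push_cast
    ring

theorem countGE_of_forall {m : ℕ} {l : List (Fin 5)} (h : ∀ a ∈ l, m ≤ (a : ℕ)) :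
    countGE m l = l.length := by
  rw [countGE, List.countP_eq_length]
  simpa using h

theorem countGE_of_five_le {m : ℕ} (hm : 5 ≤ m) (l : List (Fin 5)) : countGE m l = 0 := by
  rw [countGE, List.countP_eq_zero]
  intro a _
  simp only [decide_eq_true_eq]
  omega

theorem PIdx.ext_fst_snd {p r : PIdx} (h1 : p.fst = r.fst) (h2 : p.snd = r.snd) : p = r := by
  rcases p with ⟨i, j, hij⟩ | _ <;> rcases r with ⟨k, l, hkl⟩ | _ <;>
    simp only [PIdx.fst, PIdx.snd] at h1 h2
  · subst h1 h2; rfl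
  · omega
  · omega
  · rfl

theorem wordVec_injective : Function.Injective fun t : Tableau => wordVec t.1 := by
  rintro ⟨w, hw⟩ ⟨w', hw'⟩ h
  replace h : wordVec w = wordVec w' := h
  have hlen : w.length = w'.length := by
    have h1 := two_mul_length w
    have h2 := two_mul_length w'
    rw [h] at h1
    omega
  have hfst : w.map PIdx.fst = w'.map PIdx.fst := by
    refine eq_of_countGE_eq ((List.isChain_map _).2 (hw.imp fun _ _ h => h.1))
      ((List.isChain_map _).2 (hw'.imp fun _ _ h => h.1)) fun m => ?_
    rcases Nat.eq_zero_or_pos m with rfl | hm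
    · rw [countGE_of_forall (by simp), countGE_of_forall (by simp), List.length_map,
        List.length_map, hlen]
    rcases le_or_gt m 4 with hm4 | hm4
    · have h1 := countGE_fst w hm hm4
      have h2 := countGE_fst w' hm hm4
      rw [h] at h1
      omega
    · rw [countGE_of_five_le hm4, countGE_of_five_le hm4]
  have hsnd : w.map PIdx.snd = w'.map PIdx.snd := by
    refine eq_of_countGE_eq ((List.isChain_map _).2 (hw.imp fun _ _ h => h.2.1))
      ((List.isChain_map _).2 (hw'.imp fun _ _ h => h.2.1)) fun m => ?_
    rcases le_or_gt m 1 with hm | hm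
    · have key : ∀ v : List PIdx, ∀ a ∈ v.map PIdx.snd, m ≤ (a : ℕ) := by
        intro v a ha
        obtain ⟨p, -, rfl⟩ := List.mem_map.1 ha
        exact hm.trans p.one_le_snd
      rw [countGE_of_forall (key w), countGE_of_forall (key w'), List.length_map,
        List.length_map, hlen]
    rcases le_or_gt m 4 with hm4 | hm4
    · have h1 := countGE_snd w hm hm4
      have h2 := countGE_snd w' hm hm4
      rw [h] at h1
      omega
    · rw [countGE_of_five_le hm4, countGE_of_five_le hm4]
  have hww : w = w' := by
    refine List.ext_getElem hlen fun i h1 h2 => PIdx.ext_fst_snd ?_ ?_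
    · have := List.getElem_of_eq hfst (i := i) (by simpa using h1)
      simpa using this
    · have := List.getElem_of_eq hsnd (i := i) (by simpa using h1)
      simpa using this
  subst hww
  rfl

/-! ### Linear independence of the semistandard monomials -/

/-- In a vanishing combination, take an index of maximal leading height. No other vector of the
combination can contribute to its leading coordinate: the other leading vectors differ from it, and
the lower terms have strictly smaller height. A unit times its coefficient is therefore zero. -/
theorem linearIndependent_of_leading {ι : Type*} {x : ι → ShiftSpace} {v : ι → ℕ → ℤ}
    (hv : Function.Injective v)
    (hx : ∀ t, ∃ u : Cq, IsUnit u ∧ x t - Finsupp.single (v t) u ∈ lowerPart (height (v t))) :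
    LinearIndependent Cq x := by
  classical
  choose u hu hlow using hx
  rw [linearIndependent_iff]
  intro l hl
  by_contra hne
  obtain ⟨t, ht, hmax⟩ := Finset.exists_max_image l.support (fun t => height (v t))
    (Finsupp.support_nonempty_iff.2 hne)
  have hcoef : ∀ s ∈ l.support, x s (v t) = if s = t then u t else 0 := by
    intro s hs
    have h1 : (x s - Finsupp.single (v s) (u s)) (v t) = 0 := by
      by_contra h2
      have h3 : height (v t) < height (v s) :=
        (Finsupp.mem_supported _ _).1 (hlow s) (Finsupp.mem_support_iff.2 h2)
      exact h3.not_ge (hmax s hs)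
    rw [Finsupp.sub_apply, sub_eq_zero] at h1
    rw [h1, Finsupp.single_apply]
    by_cases hst : s = t
    · subst hst; simp
    · rw [if_neg (fun h => hst (hv h)), if_neg hst]
  have h0 : (Finsupp.linearCombination Cq x l) (v t) = l t * u t := by
    rw [Finsupp.linearCombination_apply, Finsupp.sum, Finsupp.finsetSum_apply,
      Finset.sum_eq_single t]
    · rw [Finsupp.smul_apply, hcoef t ht, if_pos rfl, smul_eq_mul]
    · intro s hs hst
      rw [Finsupp.smul_apply, hcoef s hs, if_neg hst, smul_zero]
    · exact fun h => absurd ht h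
  rw [hl, Finsupp.zero_apply] at h0
  have h1 := (hu t).mul_left_eq_zero.1 h0.symm
  exact Finsupp.mem_support_iff.1 ht h1

/-- Independence is pulled back along the linear map that lets an element act on the basis vector at
the exponent `0`. -/
theorem linearIndependent_qMinor_words :
    LinearIndependent Cq fun t : Tableau => (t.1.map qMinor).prod := by
  refine LinearIndependent.of_comp ((LinearMap.applyₗ (Finsupp.single 0 1 : ShiftSpace)) ∘ₗ
    rep.toLinearMap) ?_
  exact linearIndependent_of_leading wordVec_injective fun t => rep_word_apply t.2

end QuantumGr

namespace QuantumGr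

/-! ### The presentation and the basis -/

theorem presentedToGLq_word (w : List PIdx) :
    presentedToGLq (w.map presGen).prod = (w.map qMinor).prod := by
  rw [map_list_prod, List.map_map]
  congr 2
  funext p
  exact presentedToGLq_presGen p

theorem linearIndependent_presGen_words :
    LinearIndependent Cq fun t : Tableau => (t.1.map presGen).prod := by
  refine LinearIndependent.of_comp presentedToGLq.toLinearMap ?_
  have h : presentedToGLq.toLinearMap ∘ (fun t : Tableau => (t.1.map presGen).prod) =
      fun t : Tableau => (t.1.map qMinor).prod := funext fun t => presentedToGLq_word t.1
  rw [h]
  exact linearIndependent_qMinor_words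

/-- The semistandard monomials form a basis of the algebra defined by generators and relations. -/
noncomputable def presentedBasis : Module.Basis Tableau Cq GrPresented :=
  Module.Basis.mk linearIndependent_presGen_words standardSpan_eq_top.ge

theorem presentedBasis_apply (t : Tableau) : presentedBasis t = (t.1.map presGen).prod :=
  Module.Basis.mk_apply _ _ t

theorem injective_of_linearIndependent_comp_basis {R M N ι : Type*} [Semiring R] [AddCommMonoid M]
    [Module R M] [AddCommMonoid N] [Module R N] (b : Module.Basis ι R M) (f : M →ₗ[R] N)
    (h : LinearIndependent R (f ∘ b)) : Function.Injective f := by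
  intro x y hxy
  rw [← b.linearCombination_repr x, ← b.linearCombination_repr y,
    Finsupp.apply_linearCombination, Finsupp.apply_linearCombination] at hxy
  exact b.repr.injective (h hxy)

theorem presentedToGLq_injective : Function.Injective presentedToGLq := by
  refine injective_of_linearIndependent_comp_basis presentedBasis presentedToGLq.toLinearMap ?_
  have h : presentedToGLq.toLinearMap ∘ presentedBasis =
      fun t : Tableau => (t.1.map qMinor).prod := funext fun t =>
    (congrArg presentedToGLq (presentedBasis_apply t)).trans (presentedToGLq_word t.1)
  rw [h]
  exact linearIndependent_qMinor_words

theorem range_presentedToGLq : presentedToGLq.range = Grq := by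
  rw [Grq, Algebra.adjoin_range_eq_range_freeAlgebra_lift]
  apply le_antisymm
  · rintro _ ⟨x, rfl⟩
    obtain ⟨y, rfl⟩ := RingQuot.mkAlgHom_surjective Cq GrRel x
    exact ⟨y, (RingQuot.liftAlgHom_mkAlgHom_apply Cq evalMinors _ y).symm⟩
  · rintro _ ⟨y, rfl⟩
    exact ⟨RingQuot.mkAlgHom Cq GrRel y, RingQuot.liftAlgHom_mkAlgHom_apply Cq evalMinors _ y⟩

/-- The isomorphism between the algebra defined by generators and relations and `Gr_q`. -/
noncomputable def presentedEquiv : GrPresented ≃ₐ[Cq] Grq :=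
  (AlgEquiv.ofInjective presentedToGLq presentedToGLq_injective).trans
    (Subalgebra.equivOfEq _ _ range_presentedToGLq)

theorem presentedEquiv_presGen (p : PIdx) : presentedEquiv (presGen p) = grGen p :=
  Subtype.ext (presentedToGLq_presGen p)

/-- The basis of `Gr_q` of semistandard monomials. -/
noncomputable def grBasis : Module.Basis Tableau Cq Grq :=
  presentedBasis.map presentedEquiv.toLinearEquiv

theorem grBasis_apply (t : Tableau) : grBasis t = tableauMonomial t := by
  rw [grBasis, Module.Basis.map_apply, presentedBasis_apply, AlgEquiv.toLinearEquiv_apply,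
    map_list_prod, List.map_map, tableauMonomial]
  congr 2
  funext p
  exact presentedEquiv_presGen p

/-! ### Specialization at `q = 1` -/

theorem evalOne_C (z : ℂ) : evalOne (LaurentPolynomial.C z) = z :=
  LaurentPolynomial.eval₂_C _ _ z

theorem algebraMap_complex_eq_C (z : ℂ) : algebraMap ℂ Cq z = LaurentPolynomial.C z := rfl

/-- `O(Gr)` as an algebra over `ℂ_q`, with `q` acting as `1`. -/
noncomputable instance : Algebra Cq OGr := Algebra.compHom OGr evalOne

theorem algebraMap_OGr (c : Cq) : algebraMap Cq OGr c = algebraMap ℂ OGr (evalOne c) := rfl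

instance : IsScalarTower ℂ Cq OGr := IsScalarTower.of_algebraMap_eq fun z => by
  rw [algebraMap_OGr, algebraMap_complex_eq_C, evalOne_C]

theorem qpow_smul_OGr (k : ℤ) (z : OGr) : qpow k • z = z := by
  rw [Algebra.smul_def, algebraMap_OGr, evalOne_qpow, map_one, one_mul]

theorem lam_smul_OGr (z : OGr) : (qpow (-1) - qpow 1) • z = 0 := by
  rw [Algebra.smul_def, algebraMap_OGr, map_sub, evalOne_qpow, evalOne_qpow, sub_self, map_zero,
    zero_mul]

theorem oGen_rel {x y : FreeAlgebra ℂ PIdx} (h : OGrRel x y) :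
    RingQuot.mkAlgHom ℂ OGrRel x = RingQuot.mkAlgHom ℂ OGrRel y :=
  RingQuot.mkAlgHom_rel ℂ h

theorem mkAlgHom_x (i j : Fin 5) (h : i < j) :
    RingQuot.mkAlgHom ℂ OGrRel (x i j h) = oGen (PIdx.pair i j h) := rfl

theorem oGen_supercomm (p r : PIdx) :
    oGen p * oGen r = ((-1 : ℂ) ^ (p.parity * r.parity)) • (oGen r * oGen p) := by
  have h := oGen_rel (OGrRel.supercomm p r)
  rwa [map_smul, map_mul, map_mul] at h

theorem oGen_comm {p r : PIdx} (h : p.parity = 0 ∨ r.parity = 0) :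
    oGen p * oGen r = oGen r * oGen p := by
  rw [oGen_supercomm p r, mul_eq_zero.2 h, pow_zero, one_smul]

theorem oGen_anticomm {p r : PIdx} (hp : p.parity = 1) (hr : r.parity = 1) :
    oGen p * oGen r = -(oGen r * oGen p) := by
  rw [oGen_supercomm p r, hp, hr, mul_one, pow_one]
  exact neg_one_smul ℂ (oGen r * oGen p)

theorem parity_of_ne {i j : Fin 5} (h : i < j) (hj : j ≠ 4) : (PIdx.pair i j h).parity = 0 :=
  if_neg hj

theorem parity_odd {i : Fin 5} (h : i < 4) : (PIdx.pair i 4 h).parity = 1 := rfl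

theorem oGen_odd_mul_55 {i : Fin 5} (hi : i < 4) :
    oGen (PIdx.pair i 4 hi) * oGen PIdx.d55 = 0 := by
  have h := oGen_rel (OGrRel.odd_mul_55 i hi)
  rwa [map_mul, map_zero] at h

theorem oGen_odd_mul_odd {i j : Fin 5} (hij : i < j) (hj : j < 4) :
    oGen (PIdx.pair i 4 (hij.trans hj)) * oGen (PIdx.pair j 4 hj) =
      oGen PIdx.d55 * oGen (PIdx.pair i j hij) := by
  have h := oGen_rel (OGrRel.plucker_55 i j hij hj)
  rwa [map_mul, map_mul] at h

theorem lift_oGen_X (i j : Fin 5) (h : i < j) :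
    FreeAlgebra.lift Cq oGen (X i j h) = oGen (PIdx.pair i j h) := FreeAlgebra.lift_ι_apply _ _

theorem lift_oGen_X55 : FreeAlgebra.lift Cq oGen X55 = oGen PIdx.d55 := FreeAlgebra.lift_ι_apply _ _

/-- With `q` acting as `1`, powers of `q` disappear and the terms with factor `q⁻¹ - q` vanish,
leaving supercommutation and the classical Plücker relations. -/
theorem lift_oGen_rel {x y : FreeAlgebra Cq PIdx} (h : GrRel x y) :
    FreeAlgebra.lift Cq oGen x = FreeAlgebra.lift Cq oGen y := by
  induction h with
  | comm_overlap i j k l hij hkl hlex hcommon hodd =>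
    simp only [map_mul, map_smul, lift_oGen_X, qpow_smul_OGr]
    refine oGen_comm ?_
    by_cases hj : j = 4
    · exact Or.inr (parity_of_ne _ fun hl => hodd ⟨hj, hl⟩)
    · exact Or.inl (parity_of_ne _ hj)
  | comm_disjoint i j k l hij hjk hkl =>
    simp only [map_mul, map_smul, lift_oGen_X, qpow_smul_OGr]
    exact oGen_comm (Or.inl (parity_of_ne _ (by omega)))
  | comm_crossing i k j l hik hkj hjl =>
    simp only [map_mul, map_sub, map_smul, lift_oGen_X, qpow_smul_OGr, lam_smul_OGr, sub_zero]
    exact oGen_comm (Or.inl (parity_of_ne _ (by omega)))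
  | comm_nested i k l j hik hkl hlj =>
    simp only [map_mul, lift_oGen_X]
    exact oGen_comm (Or.inr (parity_of_ne _ (by omega)))
  | comm_even_55 i j hij hj =>
    simp only [map_mul, map_smul, lift_oGen_X, lift_oGen_X55, qpow_smul_OGr]
    exact oGen_comm (Or.inr rfl)
  | comm_odd_odd i j hij hj =>
    simp only [map_mul, map_sub, map_neg, map_smul, lift_oGen_X, qpow_smul_OGr, lam_smul_OGr,
      sub_zero]
    exact oGen_anticomm rfl rfl
  | odd_mul_55 i hi =>
    simp only [map_mul, map_zero, lift_oGen_X, lift_oGen_X55]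
    exact oGen_odd_mul_55 hi
  | mul_55_odd i hi =>
    simp only [map_mul, map_zero, lift_oGen_X, lift_oGen_X55]
    rw [oGen_comm (Or.inl rfl), oGen_odd_mul_55 hi]
  | odd_sq i hi =>
    simp only [map_mul, map_zero, lift_oGen_X]
    have h := oGen_anticomm (parity_odd hi) (parity_odd hi)
    -- The square of an odd variable is not among the relations of `O(Gr)`; it vanishes by
    -- anticommutation since 2 is invertible.
    have h2 : (2 : ℂ) • (oGen (PIdx.pair i 4 hi) * oGen (PIdx.pair i 4 hi)) = 0 := by
      rw [two_smul]
      nth_rw 1 [h]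
      exact neg_add_cancel _
    exact (smul_eq_zero.1 h2).resolve_left two_ne_zero
  | sq_55 =>
    have h := oGen_rel OGrRel.sq_55
    rw [map_mul, map_zero] at h
    simp only [map_mul, map_zero, lift_oGen_X55]
    exact h
  | plucker_even =>
    have h := oGen_rel OGrRel.plucker_even
    simp only [map_mul, map_add, map_sub, map_zero, mkAlgHom_x] at h
    simp only [map_mul, map_add, map_sub, map_smul, map_zero, lift_oGen_X, qpow_smul_OGr]
    exact h
  | plucker_odd i j k hij hjk hk =>
    have h := oGen_rel (OGrRel.plucker_odd i j k hij hjk hk)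
    simp only [map_mul, map_add, map_sub, map_zero, mkAlgHom_x] at h
    simp only [map_mul, map_add, map_sub, map_smul, map_zero, lift_oGen_X, qpow_smul_OGr]
    rw [oGen_comm (p := PIdx.pair i 4 (hij.trans (hjk.trans hk)))
      (Or.inr (parity_of_ne _ (by omega)))]
    exact h
  | plucker_55 i j hij hj =>
    simp only [map_mul, map_smul, lift_oGen_X, lift_oGen_X55, qpow_smul_OGr]
    rw [oGen_odd_mul_odd hij hj]
    exact oGen_comm (Or.inl rfl)

/-- The specialization of the presented algebra to `O(Gr)`. -/
noncomputable def presentedToOGr : GrPresented →ₐ[Cq] OGr :=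
  RingQuot.liftAlgHom Cq ⟨FreeAlgebra.lift Cq oGen, fun _ _ h => lift_oGen_rel h⟩

theorem presentedToOGr_presGen (p : PIdx) : presentedToOGr (presGen p) = oGen p := by
  rw [presentedToOGr, presGen, RingQuot.liftAlgHom_mkAlgHom_apply, FreeAlgebra.lift_ι_apply]

/-- The specialization homomorphism `Gr_q → O(Gr)`. -/
noncomputable def grqToOGr : Grq →ₐ[Cq] OGr :=
  presentedToOGr.comp (presentedEquiv.symm : Grq →ₐ[Cq] GrPresented)

theorem grqToOGr_grGen (p : PIdx) : grqToOGr (grGen p) = oGen p := by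
  rw [← presentedEquiv_presGen p]
  show presentedToOGr (presentedEquiv.symm (presentedEquiv (presGen p))) = oGen p
  rw [AlgEquiv.symm_apply_apply, presentedToOGr_presGen]

/-! ### The quotient `Gr_q / (q - 1)` and its comparison with `O(Gr)`. -/

noncomputable instance : Ring GrqAtOne := Algebra.semiringToRing ℂ

/-- The homomorphism `Gr_q / (q - 1) → O(Gr)`. -/
noncomputable def atOneToOGr : GrqAtOne →ₐ[ℂ] OGr :=
  RingQuot.liftAlgHom ℂ ⟨grqToOGr.restrictScalars ℂ, fun x y h => by
    induction h with
    | q_eq_one =>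
      rw [AlgHom.restrictScalars_apply, AlgHom.restrictScalars_apply, AlgHom.commutes,
        algebraMap_OGr, evalOne_qpow, map_one, map_one]⟩

/-- The projection `Gr_q → Gr_q / (q - 1)`. -/
noncomputable def toAtOne : Grq →ₐ[ℂ] GrqAtOne := RingQuot.mkAlgHom ℂ SpecRel

theorem toAtOne_grGen (p : PIdx) : toAtOne (grGen p) = specGen p := by
  rw [toAtOne, specGen, ← RingQuot.mkAlgHom_coe ℂ]
  rfl

theorem atOneToOGr_toAtOne (z : Grq) : atOneToOGr (toAtOne z) = grqToOGr z :=
  RingQuot.liftAlgHom_mkAlgHom_apply ℂ _ _ z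

theorem toAtOne_qpow (k : ℤ) : toAtOne (algebraMap Cq Grq (qpow k)) = 1 := by
  have h1 : toAtOne (algebraMap Cq Grq (qpow 1)) = 1 := by
    rw [toAtOne, RingQuot.mkAlgHom_rel ℂ SpecRel.q_eq_one, map_one]
  induction k using Int.induction_on with
  | zero => rw [qpow_zero, map_one, map_one]
  | succ k ih => rw [← qpow_mul, map_mul, map_mul, ih, h1, one_mul]
  | pred k ih =>
    rw [show qpow (-(k : ℤ)) = qpow (-k - 1) * qpow 1 by rw [qpow_mul, sub_add_cancel], map_mul,
      map_mul, h1, mul_one] at ih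
    exact ih

theorem toAtOne_algebraMap (c : Cq) :
    toAtOne (algebraMap Cq Grq c) = algebraMap ℂ GrqAtOne (evalOne c) := by
  induction c using LaurentPolynomial.induction_on' with
  | add f g hf hg => simp only [map_add, hf, hg]
  | C_mul_T n a =>
    have h := toAtOne_qpow n
    have h2 := evalOne_qpow n
    rw [qpow] at h h2
    rw [map_mul, map_mul, map_mul, h, h2, mul_one, mul_one, evalOne_C, ← algebraMap_complex_eq_C,
      ← IsScalarTower.algebraMap_apply ℂ Cq Grq, AlgHom.commutes]

theorem toAtOne_smul (c : Cq) (z : Grq) : toAtOne (c • z) = evalOne c • toAtOne z := by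
  rw [Algebra.smul_def, map_mul, toAtOne_algebraMap, ← Algebra.smul_def]

/-- The evaluation of the free algebra in `Gr_q`. -/
noncomputable def evalGrq : FreeAlgebra Cq PIdx →ₐ[Cq] Grq := FreeAlgebra.lift Cq grGen

theorem evalGrq_rel {x y : FreeAlgebra Cq PIdx} (h : GrRel x y) : evalGrq x = evalGrq y := by
  have e : Grq.val.comp evalGrq = evalMinors := by
    ext p
    simp [evalGrq, evalMinors, grGen]
  have := evalMinors_rel h
  rw [← e] at this
  exact Subtype.ext this

/-- The evaluation of the free algebra in `Gr_q / (q - 1)`. -/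
noncomputable def evalSpec : FreeAlgebra Cq PIdx →+* GrqAtOne :=
  (toAtOne : Grq →+* GrqAtOne).comp (evalGrq : FreeAlgebra Cq PIdx →+* Grq)

theorem evalSpec_rel {x y : FreeAlgebra Cq PIdx} (h : GrRel x y) : evalSpec x = evalSpec y :=
  congrArg toAtOne (evalGrq_rel h)

theorem evalSpec_smul (c : Cq) (z : FreeAlgebra Cq PIdx) :
    evalSpec (c • z) = evalOne c • evalSpec z := by
  show toAtOne (evalGrq (c • z)) = evalOne c • toAtOne (evalGrq z)
  rw [map_smul, toAtOne_smul]

theorem evalSpec_qpow_smul (k : ℤ) (z : FreeAlgebra Cq PIdx) :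
    evalSpec (qpow k • z) = evalSpec z := by
  rw [evalSpec_smul, evalOne_qpow, one_smul]

theorem evalSpec_lam_smul (z : FreeAlgebra Cq PIdx) :
    evalSpec ((qpow (-1) - qpow 1) • z) = 0 := by
  rw [evalSpec_smul, map_sub, evalOne_qpow, evalOne_qpow, sub_self, zero_smul]

theorem evalSpec_ι (p : PIdx) : evalSpec (FreeAlgebra.ι Cq p) = specGen p := by
  rw [← toAtOne_grGen]
  show toAtOne (evalGrq (FreeAlgebra.ι Cq p)) = _
  rw [evalGrq, FreeAlgebra.lift_ι_apply]

theorem evalSpec_X (i j : Fin 5) (h : i < j) : evalSpec (X i j h) = specGen (PIdx.pair i j h) :=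
  evalSpec_ι _

theorem evalSpec_X55 : evalSpec X55 = specGen PIdx.d55 := evalSpec_ι _

/-- Two ordered pairs share an index, are disjoint, cross or are nested; in each position the
corresponding quantum relation becomes plain commutation. -/
theorem specGen_comm_of_lex (i j k l : Fin 5) (hij : i < j) (hkl : k < l)
    (hlex : i < k ∨ (i = k ∧ j < l)) (hodd : ¬ (j = 4 ∧ l = 4)) :
    specGen (PIdx.pair i j hij) * specGen (PIdx.pair k l hkl) =
      specGen (PIdx.pair k l hkl) * specGen (PIdx.pair i j hij) := by
  by_cases hcommon : i = k ∨ i = l ∨ j = k ∨ j = l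
  · have h := evalSpec_rel (GrRel.comm_overlap i j k l hij hkl hlex hcommon hodd)
    rwa [evalSpec_qpow_smul, map_mul, map_mul, evalSpec_X, evalSpec_X] at h
  have hik : i < k := by omega
  rcases lt_or_ge j k with hjk | hkj
  · have h := evalSpec_rel (GrRel.comm_disjoint i j k l hij hjk hkl)
    rwa [evalSpec_qpow_smul, map_mul, map_mul, evalSpec_X, evalSpec_X] at h
  have hkj' : k < j := by omega
  rcases lt_or_ge j l with hjl | hlj
  · have h := evalSpec_rel (GrRel.comm_crossing i k j l hik hkj' hjl)
    rwa [map_sub, evalSpec_qpow_smul, evalSpec_lam_smul, sub_zero, map_mul, map_mul, evalSpec_X,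
      evalSpec_X] at h
  · have h := evalSpec_rel (GrRel.comm_nested i k l j hik hkl (by omega))
    rwa [map_mul, map_mul, evalSpec_X, evalSpec_X] at h

theorem specGen_anticomm_of_lt (i j : Fin 5) (hij : i < j) (hj : j < 4) :
    specGen (PIdx.pair i 4 (hij.trans hj)) * specGen (PIdx.pair j 4 hj) =
      -(specGen (PIdx.pair j 4 hj) * specGen (PIdx.pair i 4 (hij.trans hj))) := by
  have h := evalSpec_rel (GrRel.comm_odd_odd i j hij hj)
  rwa [map_sub, map_neg, evalSpec_qpow_smul, evalSpec_lam_smul, sub_zero, map_mul, map_mul,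
    evalSpec_X, evalSpec_X] at h

theorem specGen_odd_mul_55 {i : Fin 5} (hi : i < 4) :
    specGen (PIdx.pair i 4 hi) * specGen PIdx.d55 = 0 := by
  have h := evalSpec_rel (GrRel.odd_mul_55 i hi)
  rwa [map_mul, map_zero, evalSpec_X, evalSpec_X55] at h

theorem specGen_comm_55 (p : PIdx) :
    specGen p * specGen PIdx.d55 = specGen PIdx.d55 * specGen p := by
  rcases p with ⟨i, j, hij⟩ | _
  · by_cases hj : j = 4
    · subst hj
      have h := evalSpec_rel (GrRel.mul_55_odd i hij)
      rw [map_mul, map_zero, evalSpec_X, evalSpec_X55] at h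
      rw [specGen_odd_mul_55 hij, h]
    · have h := evalSpec_rel (GrRel.comm_even_55 i j hij (by omega))
      rwa [evalSpec_qpow_smul, map_mul, map_mul, evalSpec_X, evalSpec_X55] at h
  · rfl

theorem specGen_supercomm (p r : PIdx) :
    specGen p * specGen r = ((-1 : ℂ) ^ (p.parity * r.parity)) • (specGen r * specGen p) := by
  rcases p with ⟨i, j, hij⟩ | _
  swap
  · rw [show PIdx.d55.parity = 0 from rfl, zero_mul, pow_zero, one_smul, specGen_comm_55]
  rcases r with ⟨k, l, hkl⟩ | _
  swap
  · rw [show PIdx.d55.parity = 0 from rfl, mul_zero, pow_zero, one_smul, specGen_comm_55]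
  by_cases hodd : j = 4 ∧ l = 4
  · obtain ⟨rfl, rfl⟩ := hodd
    rw [parity_odd, parity_odd, mul_one, pow_one]
    refine Eq.trans ?_ (neg_one_smul ℂ _).symm
    rcases lt_trichotomy i k with hik | rfl | hki
    · exact specGen_anticomm_of_lt i k hik hkl
    · have h := evalSpec_rel (GrRel.odd_sq i hij)
      rw [map_mul, map_zero, evalSpec_X] at h
      rw [h, neg_zero]
    · rw [specGen_anticomm_of_lt k i hki hij, neg_neg]
  · have hpar : (PIdx.pair i j hij).parity * (PIdx.pair k l hkl).parity = 0 := by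
      rw [mul_eq_zero]
      by_cases hj : j = 4
      · exact Or.inr (parity_of_ne _ fun hl => hodd ⟨hj, hl⟩)
      · exact Or.inl (parity_of_ne _ hj)
    rw [hpar, pow_zero, one_smul]
    by_cases hlex : i < k ∨ (i = k ∧ j < l)
    · exact specGen_comm_of_lex i j k l hij hkl hlex hodd
    by_cases hlex' : k < i ∨ (k = i ∧ l < j)
    · exact (specGen_comm_of_lex k l i j hkl hij hlex' fun h => hodd h.symm).symm
    obtain rfl : i = k := by omega
    obtain rfl : j = l := by omega
    rfl

theorem lift_specGen_x (i j : Fin 5) (h : i < j) :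
    FreeAlgebra.lift ℂ specGen (x i j h) = specGen (PIdx.pair i j h) := FreeAlgebra.lift_ι_apply _ _

theorem lift_specGen_x55 : FreeAlgebra.lift ℂ specGen x55 = specGen PIdx.d55 :=
  FreeAlgebra.lift_ι_apply _ _

theorem specGen_comm_of_ne {i j : Fin 5} (h : i < j) (hj : j ≠ 4) (r : PIdx) :
    specGen (PIdx.pair i j h) * specGen r = specGen r * specGen (PIdx.pair i j h) := by
  rw [specGen_supercomm, parity_of_ne h hj, zero_mul, pow_zero, one_smul]

theorem lift_specGen_rel {x y : FreeAlgebra ℂ PIdx} (h : OGrRel x y) :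
    FreeAlgebra.lift ℂ specGen x = FreeAlgebra.lift ℂ specGen y := by
  induction h with
  | supercomm p r =>
    rw [map_smul, map_mul, map_mul, FreeAlgebra.lift_ι_apply, FreeAlgebra.lift_ι_apply,
      specGen_supercomm]
  | plucker_even =>
    have h := evalSpec_rel GrRel.plucker_even
    simp only [map_add, map_sub, map_zero, evalSpec_qpow_smul, map_mul, evalSpec_X] at h
    simp only [map_add, map_sub, map_zero, map_mul, lift_specGen_x]
    exact h
  | plucker_odd i j k hij hjk hk =>
    have h := evalSpec_rel (GrRel.plucker_odd i j k hij hjk hk)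
    simp only [map_add, map_sub, map_zero, evalSpec_qpow_smul, map_mul, evalSpec_X] at h
    simp only [map_add, map_sub, map_zero, map_mul, lift_specGen_x]
    rw [specGen_comm_of_ne hjk (by omega)]
    exact h
  | plucker_55 i j hij hj =>
    have h := evalSpec_rel (GrRel.plucker_55 i j hij hj)
    simp only [evalSpec_qpow_smul, map_mul, evalSpec_X, evalSpec_X55] at h
    simp only [map_mul, lift_specGen_x, lift_specGen_x55]
    rw [h, specGen_comm_55]
  | odd_mul_55 i hi =>
    simp only [map_mul, map_zero, lift_specGen_x, lift_specGen_x55]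
    exact specGen_odd_mul_55 hi
  | sq_55 =>
    have h := evalSpec_rel GrRel.sq_55
    simp only [map_mul, map_zero, evalSpec_X55] at h
    simp only [map_mul, map_zero, lift_specGen_x55]
    exact h

/-- The homomorphism `O(Gr) → Gr_q / (q - 1)`. -/
noncomputable def oGrToAtOne : OGr →ₐ[ℂ] GrqAtOne :=
  RingQuot.liftAlgHom ℂ ⟨FreeAlgebra.lift ℂ specGen, fun _ _ h => lift_specGen_rel h⟩

theorem oGrToAtOne_oGen (p : PIdx) : oGrToAtOne (oGen p) = specGen p := by
  rw [oGrToAtOne, oGen, RingQuot.liftAlgHom_mkAlgHom_apply, FreeAlgebra.lift_ι_apply]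

theorem atOneToOGr_specGen (p : PIdx) : atOneToOGr (specGen p) = oGen p := by
  rw [← toAtOne_grGen, atOneToOGr_toAtOne, grqToOGr_grGen]

/-- Agreement on the generators is not enough by itself, because one side is only `ℂ`-linear:
scalars from `Cq` also have to be compared, and both sides evaluate them at `q = 1`. -/
theorem oGrToAtOne_grqToOGr (z : Grq) : oGrToAtOne (grqToOGr z) = toAtOne z := by
  obtain ⟨z, hz⟩ := z
  induction hz using Algebra.adjoin_induction with
  | mem x hx =>
    obtain ⟨p, rfl⟩ := hx
    exact (congrArg oGrToAtOne (grqToOGr_grGen p)).trans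
      ((oGrToAtOne_oGen p).trans (toAtOne_grGen p).symm)
  | algebraMap c =>
    show oGrToAtOne (grqToOGr (algebraMap Cq Grq c)) = toAtOne (algebraMap Cq Grq c)
    rw [AlgHom.commutes, algebraMap_OGr, AlgHom.commutes, toAtOne_algebraMap]
  | add x y hx hy ihx ihy =>
    have e : (⟨x + y, add_mem hx hy⟩ : Grq) = ⟨x, hx⟩ + ⟨y, hy⟩ := rfl
    rw [e, map_add, map_add, map_add, ihx, ihy]
  | mul x y hx hy ihx ihy =>
    have e : (⟨x * y, mul_mem hx hy⟩ : Grq) = ⟨x, hx⟩ * ⟨y, hy⟩ := rfl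
    rw [e, map_mul, map_mul, map_mul, ihx, ihy]

/-- The isomorphism `Gr_q / (q - 1) ≅ O(Gr)`. -/
noncomputable def atOneEquiv : GrqAtOne ≃ₐ[ℂ] OGr :=
  AlgEquiv.ofAlgHom atOneToOGr oGrToAtOne
    (by
      refine RingQuot.ringQuot_ext' ℂ _ _ (FreeAlgebra.hom_ext ?_)
      funext p
      show atOneToOGr (oGrToAtOne (oGen p)) = oGen p
      rw [oGrToAtOne_oGen, atOneToOGr_specGen])
    (by
      refine RingQuot.ringQuot_ext' ℂ _ _ (AlgHom.ext fun z => ?_)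
      show oGrToAtOne (atOneToOGr (toAtOne z)) = toAtOne z
      rw [atOneToOGr_toAtOne, oGrToAtOne_grqToOGr])

end QuantumGr

theorem mainTheorem1 :
    -- `Gr_q` is presented by the commutation and Plücker relations, with `X_p ↦ D_p`
    (∃ e : QuantumGr.GrPresented ≃ₐ[QuantumGr.Cq] QuantumGr.Grq,
      ∀ p : QuantumGr.PIdx, e (QuantumGr.presGen p) = QuantumGr.grGen p) ∧
    -- the specialization at `q = 1` is `O(Gr)`, with `D_p` going to the Plücker coordinate
    (∃ e : QuantumGr.GrqAtOne ≃ₐ[ℂ] QuantumGr.OGr,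
      ∀ p : QuantumGr.PIdx, e (QuantumGr.specGen p) = QuantumGr.oGen p) ∧
    -- the semistandard monomials form a basis of `Gr_q` over `ℂ_q`
    (∃ b : Module.Basis QuantumGr.Tableau QuantumGr.Cq QuantumGr.Grq,
      ∀ t : QuantumGr.Tableau, b t = QuantumGr.tableauMonomial t) :=
  ⟨⟨QuantumGr.presentedEquiv, QuantumGr.presentedEquiv_presGen⟩,
    ⟨QuantumGr.atOneEquiv, QuantumGr.atOneToOGr_specGen⟩,
    ⟨QuantumGr.grBasis, QuantumGr.grBasis_apply⟩⟩
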